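/- Let $\beta(t)=\dfrac{e^{-\sigma t}t^{\alpha-1}\cos(\gamma t)}{\Gamma(\alpha)}$, where either (i) $\alpha=1$, $\sigma>1$, $0\le\gamma\le\sigma$, or (ii) $\alpha=\tfrac12$, $\sigma>1$, $0\le\gamma\le\sqrt3\,\sigma$. Then there is a constant $C>0$, depending only on $\alpha,\sigma,\gamma$, such that the following holds. Let $d\in\{1,2,3\}$, let $\Omega\subset\mathbb R^d$ be a bounded domain with smooth boundary, and let $(\cdot,\cdot)$ and $\|\cdot\|$ be the inner product and the norm of $L^2(\Omega)$. Let $\mu_1,\mu_2\ge0$ with $\mu_1^2+\mu_2^2>0$, and let $G:[0,\infty)\to[0,\infty)$ be continuously differentiable with $0\le G'(z)\le\mathcal L$ for all $z\ge0$ and some constant $\mathcal L$. Let $0<T\le\infty$, $f\in L^1(0,T;L^2(\Omega))$, let $\mathcal S_h\subset H^1_0(\Omega)$ be a finite-dimensional subspace, and let $u_{0h},u_{1h}\in\mathcal S_h$. Let $u_h$ be a solution of the semi-discrete Galerkin scheme, that is, a continuously differentiable function of the times $0\le t\le T$ ($0\le t<\infty$ if $T=\infty$) with values in $\mathcal S_h$,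 whose derivative $u_h'$ is locally absolutely continuous, with $u_h(0)=u_{0h}$, $u_h'(0)=u_{1h}$ and, for almost every $t\in(0,T)$ and all $v_h\in\mathcal S_h$, $$(u_h''(t),v_h)+G\big(\mu_1\|u_h(t)\|^2+\mu_2\|\nabla u_h(t)\|^2\big)(u_h'(t),v_h)+(\nabla u_h(t),\nabla v_h)-\int_0^t\beta(t-s)(\nabla u_h(s),\nabla v_h)\,ds=(f(t),v_h).$$ Then $$\|u_h'(t)\|+\|\nabla u_h(t)\|\le C\Big(\|u_{1h}\|+\|\nabla u_{0h}\|+\int_0^t\|f(s)\|\,ds\Big)$$ for all real $t$ with $0<t\le T$. In particular, $C$ does not depend on $t$, $T$ or $\mathcal S_h$ (hence not on the mesh size). -/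

import Mathlib

open MeasureTheory Set
open scoped ContDiff ENNReal Topology

noncomputable section

namespace HypInteg

/-- The Euclidean space `ℝ^d`. -/
abbrev E (d : ℕ) : Type := EuclideanSpace ℝ (Fin d)

/-- The boundary of `Ω` is smooth: near each boundary point, `Ω` is the set where a smooth function
with non-vanishing differential is negative. -/
def HasSmoothBoundary {d : ℕ} (Ω : Set (E d)) : Prop :=
  ∀ x ∈ frontier Ω, ∃ U ∈ 𝓝 x, ∃ φ : E d → ℝ,
    ContDiff ℝ ∞ φ ∧ fderiv ℝ φ x ≠ 0 ∧ ∀ y ∈ U, (y ∈ Ω ↔ φ y < 0)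

/-- Bounded domain with smooth boundary (a domain is open, connected and nonempty). -/
structure IsSmoothBoundedDomain {d : ℕ} (Ω : Set (E d)) : Prop where
  isOpen : IsOpen Ω
  isConnected : IsConnected Ω
  isBounded : Bornology.IsBounded Ω
  smooth : HasSmoothBoundary Ω

/-- `L²(Ω)`, real valued. -/
abbrev L2 {d : ℕ} (Ω : Set (E d)) : Type := Lp ℝ 2 (volume.restrict Ω)

/-- `L²(Ω; ℝ^d)`. -/
abbrev L2Vec {d : ℕ} (Ω : Set (E d)) : Type := Lp (E d) 2 (volume.restrict Ω)

/-- `L²(Ω) × L²(Ω; ℝ^d)` with the Hilbert norm `(‖u‖² + ‖g‖²)^(1/2)`. A function `u ∈ H¹(Ω)` is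
represented by the pair `(u, ∇u)` in it, so that its norm is the `H¹` norm of `u`. -/
abbrev L2Pair {d : ℕ} (Ω : Set (E d)) : Type := WithLp 2 (L2 Ω × L2Vec Ω)

/-- `φ ∈ C_c^∞(Ω)`. -/
structure IsTest {d : ℕ} (Ω : Set (E d)) (φ : E d → ℝ) : Prop where
  smooth : ContDiff ℝ ∞ φ
  compact : HasCompactSupport φ
  supp : tsupport φ ⊆ Ω

/-- `g` is the weak gradient of `u` in `Ω`. -/
def HasWeakGradient {d : ℕ} {Ω : Set (E d)} (u : L2 Ω) (g : L2Vec Ω) : Prop :=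
  ∀ φ : E d → ℝ, IsTest Ω φ → ∀ e : E d,
    ∫ x in Ω, u x * fderiv ℝ φ x e = - ∫ x in Ω, inner ℝ (g x) e * φ x

theorem IsTest.memLp {d : ℕ} {Ω : Set (E d)} {φ : E d → ℝ} (h : IsTest Ω φ) :
    MemLp φ 2 (volume.restrict Ω) :=
  (h.smooth.continuous.memLp_of_hasCompactSupport h.compact).restrict _

theorem IsTest.memLp_fderiv {d : ℕ} {Ω : Set (E d)} {φ : E d → ℝ} (h : IsTest Ω φ) (e : E d) :
    MemLp (fun x => fderiv ℝ φ x e) 2 (volume.restrict Ω) := by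
  have hc : Continuous (fun x => fderiv ℝ φ x e) :=
    (h.smooth.continuous_fderiv (by simp)).clm_apply continuous_const
  have hs : HasCompactSupport (fun x => fderiv ℝ φ x e) := h.compact.fderiv_apply ℝ e
  exact (hc.memLp_of_hasCompactSupport hs).restrict _

/-- The Sobolev space `H¹(Ω)`, as the space of the pairs `(u, ∇u)`. -/
def H1 {d : ℕ} (Ω : Set (E d)) : Submodule ℝ (L2Pair Ω) where
  carrier := {p | HasWeakGradient p.fst p.snd}
  zero_mem' := by
    intro φ _ e
    have h1 : ∀ᵐ x ∂(volume.restrict Ω), (0 : L2 Ω) x = 0 := Lp.coeFn_zero ..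
    have h2 : ∀ᵐ x ∂(volume.restrict Ω), (0 : L2Vec Ω) x = 0 := Lp.coeFn_zero ..
    have e1 : ∫ x in Ω, (0 : L2 Ω) x * fderiv ℝ φ x e = 0 :=
      integral_eq_zero_of_ae (by filter_upwards [h1] with x hx; rw [hx]; simp)
    have e2 : ∫ x in Ω, inner ℝ ((0 : L2Vec Ω) x) e * φ x = 0 :=
      integral_eq_zero_of_ae (by filter_upwards [h2] with x hx; rw [hx]; simp)
    simp only [WithLp.zero_fst, WithLp.zero_snd]
    rw [e1, e2, neg_zero]
  add_mem' := by
    intro p q hp hq φ hφ e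
    have hp' := hp φ hφ e
    have hq' := hq φ hφ e
    have i1 : ∀ u : L2 Ω, Integrable (fun x => u x * fderiv ℝ φ x e) (volume.restrict Ω) :=
      fun u => (Lp.memLp u).integrable_mul (hφ.memLp_fderiv e)
    have i2 : ∀ g : L2Vec Ω, Integrable (fun x => inner ℝ (g x) e * φ x) (volume.restrict Ω) :=
      fun g => ((Lp.memLp g).inner_const e).integrable_mul hφ.memLp
    have e1 : ∫ x in Ω, (p.fst + q.fst) x * fderiv ℝ φ x e
        = (∫ x in Ω, p.fst x * fderiv ℝ φ x e) + ∫ x in Ω, q.fst x * fderiv ℝ φ x e := by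
      rw [← integral_add (i1 _) (i1 _)]
      refine integral_congr_ae ?_
      filter_upwards [Lp.coeFn_add p.fst q.fst] with x hx
      simp only [hx, Pi.add_apply]; ring
    have e2 : ∫ x in Ω, inner ℝ ((p.snd + q.snd) x) e * φ x
        = (∫ x in Ω, inner ℝ (p.snd x) e * φ x) + ∫ x in Ω, inner ℝ (q.snd x) e * φ x := by
      rw [← integral_add (i2 _) (i2 _)]
      refine integral_congr_ae ?_
      filter_upwards [Lp.coeFn_add p.snd q.snd] with x hx
      simp only [hx, Pi.add_apply, inner_add_left]; ring
    simp only [WithLp.add_fst, WithLp.add_snd]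
    rw [e1, e2, hp', hq']; ring
  smul_mem' := by
    intro c p hp φ hφ e
    have hp' := hp φ hφ e
    have e1 : ∫ x in Ω, (c • p.fst) x * fderiv ℝ φ x e
        = c * ∫ x in Ω, p.fst x * fderiv ℝ φ x e := by
      rw [← integral_const_mul]
      refine integral_congr_ae ?_
      filter_upwards [Lp.coeFn_smul c p.fst] with x hx
      simp only [hx, Pi.smul_apply, smul_eq_mul]; ring
    have e2 : ∫ x in Ω, inner ℝ ((c • p.snd) x) e * φ x
        = c * ∫ x in Ω, inner ℝ (p.snd x) e * φ x := by
      rw [← integral_const_mul]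
      refine integral_congr_ae ?_
      filter_upwards [Lp.coeFn_smul c p.snd] with x hx
      simp only [hx, Pi.smul_apply, real_inner_smul_left]; ring
    simp only [WithLp.smul_fst, WithLp.smul_snd]
    rw [e1, e2, hp']; ring

/-- The pairs `(φ, ∇φ)` with `φ ∈ C_c^∞(Ω)`. -/
def testPairs {d : ℕ} (Ω : Set (E d)) : Set (L2Pair Ω) :=
  {p | ∃ φ : E d → ℝ, IsTest Ω φ ∧
    (p.fst : E d → ℝ) =ᵐ[volume.restrict Ω] φ ∧
    (p.snd : E d → E d) =ᵐ[volume.restrict Ω] gradient φ}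

/-- `H¹₀(Ω)`: the closure of `C_c^∞(Ω)` in `H¹(Ω)`. -/
def H10 {d : ℕ} (Ω : Set (E d)) : Submodule ℝ (L2Pair Ω) :=
  H1 Ω ⊓ (Submodule.span ℝ (testPairs Ω)).topologicalClosure

/-- The kernel `β(t) = e^{-σt} t^{α-1} cos(γt) / Γ(α)`. -/
def kernel (α σ γ t : ℝ) : ℝ :=
  Real.exp (-σ * t) * t ^ (α - 1) * Real.cos (γ * t) / Real.Gamma α

/-- The admissible parameters of the kernel. -/
def KernelCond (α σ γ : ℝ) : Prop :=
  (α = 1 ∧ 1 < σ ∧ 0 ≤ γ ∧ γ ≤ σ) ∨ (α = 1 / 2 ∧ 1 < σ ∧ 0 ≤ γ ∧ γ ≤ Real.sqrt 3 * σ)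

/-- The function `G : [0, ∞) → [0, ∞)` is continuously differentiable with `0 ≤ G' ≤ L`
(its values at negative arguments play no role). -/
structure DampingCond (G : ℝ → ℝ) (L : ℝ) : Prop where
  nonneg : ∀ z, 0 ≤ z → 0 ≤ G z
  contDiff : ContDiffOn ℝ 1 G (Ici 0)
  deriv_nonneg : ∀ z, 0 ≤ z → 0 ≤ derivWithin G (Ici 0) z
  deriv_le : ∀ z, 0 ≤ z → derivWithin G (Ici 0) z ≤ L

/-- The times `0 ≤ t ≤ T`, that is `[0, T]` for finite `T` and `[0, ∞)` for `T = ∞`. -/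
def timeInterval (T : ℝ≥0∞) : Set ℝ := {t | 0 ≤ t ∧ ENNReal.ofReal t ≤ T}

/-- `u` is a solution, with values in the subspace `S` of `H¹₀(Ω)`, of the Galerkin scheme
with initial data `u(0) = u₀`, `u'(0) = u₁`. Here `du = u'` is the classical time derivative of
`u`, and `ddu = u''` the derivative of the locally absolutely continuous function `u'`; since `f`
is only integrable in time, the equation holds at almost every time. For `v ∈ S`, the components
`v.fst` and `v.snd` are the function `v` and its gradient. -/
structure IsGalerkinSolution {d : ℕ} {Ω : Set (E d)} (S : Submodule ℝ (L2Pair Ω))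
    (β G : ℝ → ℝ) (μ₁ μ₂ : ℝ) (T : ℝ≥0∞) (f : ℝ → L2 Ω) (u₀ u₁ : S)
    (u du ddu : ℝ → S) : Prop where
  init : u 0 = u₀
  init_deriv : du 0 = u₁
  hasDeriv : ∀ t ∈ timeInterval T, HasDerivWithinAt u (du t) (timeInterval T) t
  integrable : ∀ t ∈ timeInterval T, IntervalIntegrable ddu volume 0 t
  deriv_eq : ∀ t ∈ timeInterval T, du t = du 0 + ∫ s in (0 : ℝ)..t, ddu s
  equation : ∀ᵐ t ∂(volume.restrict (timeInterval T)), ∀ v : S,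
    inner ℝ (ddu t : L2Pair Ω).fst (v : L2Pair Ω).fst
      + G (μ₁ * ‖(u t : L2Pair Ω).fst‖ ^ 2 + μ₂ * ‖(u t : L2Pair Ω).snd‖ ^ 2)
          * inner ℝ (du t : L2Pair Ω).fst (v : L2Pair Ω).fst
      + inner ℝ (u t : L2Pair Ω).snd (v : L2Pair Ω).snd
      - ∫ s in (0 : ℝ)..t,
          β (t - s) * inner ℝ (u s : L2Pair Ω).snd (v : L2Pair Ω).snd
    = inner ℝ (f t) (v : L2Pair Ω).fst

end HypInteg

end

/-! Test the scheme with `v = u'`. The damping term is then nonnegative and is dropped, so `G` and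
the `μᵢ` enter only through their signs. With `p = u'`, `w = ∇u` and the tail `K(t) = ∫_t^∞ β`,
integration by parts in `s` turns the memory term into `K(0)(w(t), w'(t)) - K(t)(w(0), w'(t)) - ∫₀ᵗ
K(t-s)(w'(s), w'(t)) ds`. Integrated in time, the last piece has a favourable sign as soon as `K` is
of positive type. The first piece only lowers the coefficient of the potential energy to `1 - K(0)`,
which is at least `1 - σ^{-α} > 0`. The middle piece is integrated by parts once more and costs at
most a multiple of `‖w(0)‖ max ‖w‖`. Evaluating at the time of maximal energy makes the right side
linear in the square root of that maximum, and one factor cancels. No Gronwall argument occurs,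
hence no dependence on `T` (`energy_le_of_positive_type`, `norm_add_norm_le_of_positive_type`).

Positive type is a Bochner argument. The even extension of `K` has the cosine transform `2 S(η)/η`,
where `S` is the sine transform of `β`. If `S ≥ 0` and `S` decays like `η^{-1/2}`, Fourier inversion
writes `K` as a nonnegative integrable superposition of cosines
(`exists_cos_density_of_sineTransform_nonneg`), and each cosine contributes a sum of two squares.
The restrictions on `γ` serve to give `S ≥ 0`: by a rational formula for `α = 1`, and through the
square root of `1/(σ - iy)` for `α = 1/2` (`dampedSine_half_le_of_lt`). -/

/-! ### Integrals over a triangle and kernels of positive type. -/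

/-- The integral of a symmetric function over a triangle is half its integral over the square. -/
theorem integral_triangle_of_symm {T : ℝ} (hT : 0 ≤ T) {F : ℝ → ℝ → ℝ}
    (hs : ∀ t s, F t s = F s t)
    (hF : Integrable (fun z : ℝ × ℝ => F z.1 z.2)
      ((volume.restrict (Ioc 0 T)).prod (volume.restrict (Ioc 0 T)))) :
    2 * ∫ t in (0 : ℝ)..T, ∫ s in (0 : ℝ)..t, F t s
      = ∫ z, F z.1 z.2 ∂((volume.restrict (Ioc 0 T)).prod (volume.restrict (Ioc 0 T))) := by
  set μ : Measure ℝ := volume.restrict (Ioc 0 T) with hμ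
  have hD : MeasurableSet {z : ℝ × ℝ | z.2 ≤ z.1} := measurableSet_le measurable_snd measurable_fst
  have hD' : MeasurableSet {z : ℝ × ℝ | z.2 < z.1} := measurableSet_lt measurable_snd measurable_fst
  -- Swapping coordinates sends the complement of the closed triangle to the open triangle; the two
  -- triangles differ by the diagonal, a null set.
  have hdiag : (μ.prod μ) {z : ℝ × ℝ | z.1 = z.2} = 0 := by
    rw [Measure.measure_prod_null (measurableSet_eq_fun measurable_fst measurable_snd)]
    refine Filter.Eventually.of_forall fun x => ?_
    have : Prod.mk x ⁻¹' {z : ℝ × ℝ | z.1 = z.2} = {x} := by ext y; simp [eq_comm]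
    show μ (Prod.mk x ⁻¹' {z : ℝ × ℝ | z.1 = z.2}) = 0
    rw [this]; simp
  have h1 : ∫ z in {z : ℝ × ℝ | z.2 ≤ z.1}, F z.1 z.2 ∂(μ.prod μ)
      = ∫ z in {z : ℝ × ℝ | z.2 < z.1}, F z.1 z.2 ∂(μ.prod μ) := by
    refine setIntegral_congr_set ?_
    have : ∀ᵐ z ∂(μ.prod μ), z.1 ≠ z.2 := by
      rw [ae_iff]; simpa using hdiag
    filter_upwards [this] with z hz
    refine propext (show z.2 ≤ z.1 ↔ z.2 < z.1 from ⟨fun h => lt_of_le_of_ne h hz.symm, le_of_lt⟩)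
  have h2 : ∫ z in {z : ℝ × ℝ | z.2 ≤ z.1}ᶜ, F z.1 z.2 ∂(μ.prod μ)
      = ∫ z in {z : ℝ × ℝ | z.2 < z.1}, F z.1 z.2 ∂(μ.prod μ) := by
    rw [← integral_indicator hD.compl, ← integral_indicator hD', ← integral_prod_swap]
    refine integral_congr_ae (Filter.Eventually.of_forall fun z => ?_)
    simp only [indicator, mem_compl_iff, mem_ofPred_eq, Prod.fst_swap, Prod.snd_swap, not_le]
    simp only [hs z.1 z.2]
  have h3 := integral_add_compl hD hF
  have h4 : ∫ t in (0 : ℝ)..T, ∫ s in (0 : ℝ)..t, F t s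
      = ∫ z in {z : ℝ × ℝ | z.2 ≤ z.1}, F z.1 z.2 ∂(μ.prod μ) := by
    rw [← integral_indicator hD, integral_prod _ (hF.indicator hD),
      intervalIntegral.integral_of_le hT]
    refine setIntegral_congr_fun measurableSet_Ioc fun t ht => ?_
    have e : Ioc 0 t = Ioc 0 T ∩ Iic t := by
      ext s; simp only [mem_Ioc, mem_inter_iff, mem_Iic]
      exact ⟨fun h => ⟨⟨h.1, h.2.trans ht.2⟩, h.2⟩, fun h => ⟨h.1.1, h.2⟩⟩
    rw [intervalIntegral.integral_of_le ht.1.le, e, inter_comm, ← Measure.restrict_restrict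
      measurableSet_Iic, ← integral_indicator measurableSet_Iic]
    rfl
  rw [h4]
  linarith

section PositiveType

variable {H : Type*} [NormedAddCommGroup H] [InnerProductSpace ℝ H]

theorem integrable_inner_prod {μ ν : Measure ℝ} {f g : ℝ → H} (hf : Integrable f μ)
    (hg : Integrable g ν) :
    Integrable (fun z : ℝ × ℝ => (inner ℝ (f z.1) (g z.2) : ℝ)) (μ.prod ν) :=
  Integrable.op_fst_snd (op := fun x y : H => (inner ℝ x y : ℝ)) (by fun_prop)
    ⟨1, fun x y => by simpa using abs_real_inner_le_norm x y⟩ hf hg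

variable [CompleteSpace H]

/-- The energy identity for an absolutely continuous curve in a Hilbert space. -/
theorem integral_inner_of_eq_integral {T : ℝ} (hT : 0 ≤ T) {p p' : ℝ → H}
    (hp' : IntervalIntegrable p' volume 0 T)
    (hp : ∀ t ∈ Icc 0 T, p t = p 0 + ∫ s in (0 : ℝ)..t, p' s) :
    2 * ∫ t in (0 : ℝ)..T, inner ℝ (p' t) (p t) = ‖p T‖ ^ 2 - ‖p 0‖ ^ 2 := by
  have hi : IntegrableOn p' (Ioc 0 T) := (intervalIntegrable_iff_integrableOn_Ioc_of_le hT).1 hp'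
  have hpr : Integrable (fun z : ℝ × ℝ => (inner ℝ (p' z.1) (p' z.2) : ℝ))
      ((volume.restrict (Ioc 0 T)).prod (volume.restrict (Ioc 0 T))) :=
    integrable_inner_prod hi hi
  -- Symmetry of the inner product makes the triangle integral half of `‖∫ p'‖²`, so `p` never has
  -- to be differentiated almost everywhere.
  have h1 := integral_triangle_of_symm hT (F := fun t s => inner ℝ (p' t) (p' s))
    (fun t s => real_inner_comm _ _) hpr
  have h2 : ∫ z : ℝ × ℝ, (inner ℝ (p' z.1) (p' z.2) : ℝ)
      ∂((volume.restrict (Ioc 0 T)).prod (volume.restrict (Ioc 0 T)))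
      = inner ℝ (∫ s in Ioc 0 T, p' s) (∫ s in Ioc 0 T, p' s) :=
    integral_prod_bilin (innerSL ℝ) hi hi
  have hii : ∀ t ∈ Icc 0 T, IntervalIntegrable p' volume 0 t := fun t ht =>
    hp'.mono_set (by rw [uIcc_of_le ht.1, uIcc_of_le hT]; exact Icc_subset_Icc_right ht.2)
  have hcont : ContinuousOn (fun t => ∫ s in (0 : ℝ)..t, p' s) (uIcc 0 T) :=
    intervalIntegral.continuousOn_primitive_interval
      (by rw [uIcc_of_le hT]; exact (integrableOn_Icc_iff_integrableOn_Ioc).2 hi)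
  have hint0 : IntervalIntegrable (fun t => (inner ℝ (p' t) (p 0) : ℝ)) volume 0 T := by
    rw [intervalIntegrable_iff_integrableOn_Ioc_of_le hT]
    exact hi.inner_const _
  have hint1 : IntervalIntegrable (fun t => (inner ℝ (p' t) (∫ s in (0 : ℝ)..t, p' s) : ℝ))
      volume 0 T := by
    rw [intervalIntegrable_iff_integrableOn_Ioc_of_le hT]
    have hc : AEStronglyMeasurable (fun t => ∫ s in (0 : ℝ)..t, p' s)
        (volume.restrict (Ioc 0 T)) :=
      (hcont.mono (by rw [uIcc_of_le hT]; exact Ioc_subset_Icc_self)).aestronglyMeasurable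
        measurableSet_Ioc
    obtain ⟨C, hC⟩ := isCompact_uIcc.exists_bound_of_continuousOn hcont
    refine Integrable.mono' (hi.norm.mul_const C)
      (hi.aestronglyMeasurable.inner hc) ?_
    filter_upwards [ae_restrict_mem measurableSet_Ioc] with t ht
    refine (norm_inner_le_norm _ _).trans ?_
    gcongr
    exact hC t (by rw [uIcc_of_le hT]; exact Ioc_subset_Icc_self ht)
  have h3 : ∫ t in (0 : ℝ)..T, inner ℝ (p' t) (p t)
      = (∫ t in (0 : ℝ)..T, inner ℝ (p' t) (p 0))
        + ∫ t in (0 : ℝ)..T, ∫ s in (0 : ℝ)..t, inner ℝ (p' t) (p' s) := by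
    rw [← intervalIntegral.integral_add hint0]
    · refine intervalIntegral.integral_congr fun t ht => ?_
      rw [uIcc_of_le hT] at ht
      rw [hp t ht, inner_add_right]
      congr 1
      rw [intervalIntegral.integral_of_le ht.1, intervalIntegral.integral_of_le ht.1]
      exact (integral_inner ((intervalIntegrable_iff_integrableOn_Ioc_of_le ht.1).1 (hii t ht)) _).symm
    · refine hint1.congr ?_
      intro t ht
      rw [uIoc_of_le hT] at ht
      simp only
      rw [intervalIntegral.integral_of_le ht.1.le, intervalIntegral.integral_of_le ht.1.le]
      exact (integral_inner ((intervalIntegrable_iff_integrableOn_Ioc_of_le ht.1.le).1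
        (hii t (Ioc_subset_Icc_self ht))) _).symm
  have h4 : ∫ t in (0 : ℝ)..T, inner ℝ (p' t) (p 0)
      = inner ℝ (∫ s in Ioc 0 T, p' s) (p 0) := by
    rw [intervalIntegral.integral_of_le hT]
    simp_rw [real_inner_comm (p 0)]
    rw [integral_inner hi]
  rw [h3, mul_add, h1, h2, h4, hp T ⟨hT, le_rfl⟩, intervalIntegral.integral_of_le hT]
  set J := ∫ s in Ioc 0 T, p' s
  rw [norm_add_sq_real, real_inner_self_eq_norm_sq, real_inner_comm]
  ring

/-- An even superposition of cosines with a nonnegative integrable density is of positive type. -/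
theorem integral_triangle_nonneg_of_cos {K R : ℝ → ℝ} (hR : Integrable R) (hR0 : ∀ ξ, 0 ≤ R ξ)
    (hK : ∀ t, 0 ≤ t → K t = ∫ ξ, R ξ * Real.cos (2 * Real.pi * ξ * t))
    {T : ℝ} (hT : 0 ≤ T) {φ : ℝ → H} (hφ : IntegrableOn φ (Ioc 0 T)) :
    0 ≤ ∫ t in (0 : ℝ)..T, ∫ s in (0 : ℝ)..t, K (t - s) * inner ℝ (φ s) (φ t) := by
  set μ : Measure ℝ := volume.restrict (Ioc 0 T) with hμ
  have hi : Integrable φ μ := hφ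
  have hB : Integrable (fun z : ℝ × ℝ => (inner ℝ (φ z.1) (φ z.2) : ℝ)) (μ.prod μ) :=
    integrable_inner_prod hi hi
  have hbig : Integrable (fun q : (ℝ × ℝ) × ℝ => (R q.2 * Real.cos (2 * Real.pi * q.2 * (q.1.1 - q.1.2)))
      * inner ℝ (φ q.1.1) (φ q.1.2)) ((μ.prod μ).prod volume) := by
    have h := (hB.mul_prod hR).bdd_mul (c := 1)
      (f := fun q : (ℝ × ℝ) × ℝ => Real.cos (2 * Real.pi * q.2 * (q.1.1 - q.1.2)))
      (Continuous.aestronglyMeasurable (by fun_prop))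
      (Filter.Eventually.of_forall fun q => by simpa using Real.abs_cos_le_one _)
    refine h.congr (Filter.Eventually.of_forall fun q => ?_)
    simp only; ring
  have hF : ∀ z : ℝ × ℝ, ∫ ξ, (R ξ * Real.cos (2 * Real.pi * ξ * (z.1 - z.2)))
      * inner ℝ (φ z.1) (φ z.2) = K |z.1 - z.2| * inner ℝ (φ z.1) (φ z.2) := by
    intro z
    rw [integral_mul_const, hK _ (abs_nonneg _)]
    congr 2
    ext ξ
    rcases abs_choice (z.1 - z.2) with h | h <;> rw [h]
    rw [mul_neg, Real.cos_neg]
  have hFi : Integrable (fun z : ℝ × ℝ => K |z.1 - z.2| * inner ℝ (φ z.1) (φ z.2)) (μ.prod μ) :=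
    hbig.integral_prod_left.congr (Filter.Eventually.of_forall hF)
  have h1 := integral_triangle_of_symm hT
    (F := fun t s => K |t - s| * inner ℝ (φ t) (φ s))
    (fun t s => by rw [abs_sub_comm, real_inner_comm]) hFi
  have h2 : ∫ t in (0 : ℝ)..T, ∫ s in (0 : ℝ)..t, K (t - s) * inner ℝ (φ s) (φ t)
      = ∫ t in (0 : ℝ)..T, ∫ s in (0 : ℝ)..t, K |t - s| * inner ℝ (φ t) (φ s) := by
    refine intervalIntegral.integral_congr fun t ht => ?_
    rw [uIcc_of_le hT] at ht
    refine intervalIntegral.integral_congr fun s hs => ?_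
    rw [uIcc_of_le ht.1] at hs
    rw [abs_of_nonneg (sub_nonneg.2 hs.2), real_inner_comm]
  have h3 : 0 ≤ ∫ z, K |z.1 - z.2| * inner ℝ (φ z.1) (φ z.2) ∂(μ.prod μ) := by
    simp_rw [← hF]
    rw [integral_integral_swap (f := fun (z : ℝ × ℝ) (ξ : ℝ) =>
      (R ξ * Real.cos (2 * Real.pi * ξ * (z.1 - z.2))) * inner ℝ (φ z.1) (φ z.2)) hbig]
    refine integral_nonneg fun ξ => ?_
    have hc : Integrable (fun s => Real.cos (2 * Real.pi * ξ * s) • φ s) μ :=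
      hi.bdd_smul 1 (Continuous.aestronglyMeasurable (by fun_prop))
        (Filter.Eventually.of_forall fun q => by simpa using Real.abs_cos_le_one _)
    have hs : Integrable (fun s => Real.sin (2 * Real.pi * ξ * s) • φ s) μ :=
      hi.bdd_smul 1 (Continuous.aestronglyMeasurable (by fun_prop))
        (Filter.Eventually.of_forall fun q => by simpa using Real.abs_sin_le_one _)
    have key : ∀ g : ℝ → H, Integrable g μ →
        Integrable (fun z : ℝ × ℝ => (inner ℝ (g z.1) (g z.2) : ℝ)) (μ.prod μ) ∧
        ∫ z : ℝ × ℝ, (inner ℝ (g z.1) (g z.2) : ℝ) ∂(μ.prod μ) = ‖∫ s, g s ∂μ‖ ^ 2 := by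
      intro g hg
      refine ⟨integrable_inner_prod hg hg, ?_⟩
      rw [← real_inner_self_eq_norm_sq]
      exact integral_prod_bilin (innerSL ℝ) hg hg
    -- The addition formula for `cos (a - b)` separates the variables: at a fixed frequency the form
    -- is `R ξ` times the sum of the squared norms of `∫ cos • φ` and `∫ sin • φ`.
    have e : ∀ z : ℝ × ℝ, (R ξ * Real.cos (2 * Real.pi * ξ * (z.1 - z.2))) * inner ℝ (φ z.1) (φ z.2)
        = R ξ * (inner ℝ (Real.cos (2 * Real.pi * ξ * z.1) • φ z.1)
            (Real.cos (2 * Real.pi * ξ * z.2) • φ z.2)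
          + inner ℝ (Real.sin (2 * Real.pi * ξ * z.1) • φ z.1)
            (Real.sin (2 * Real.pi * ξ * z.2) • φ z.2)) := by
      intro z
      simp only [real_inner_smul_left, real_inner_smul_right, mul_sub, Real.cos_sub]
      ring
    simp only [Pi.zero_apply]
    simp_rw [e]
    rw [integral_const_mul, integral_add (key _ hc).1 (key _ hs).1, (key _ hc).2, (key _ hs).2]
    have := hR0 ξ
    positivity
  rw [h2]
  linarith

end PositiveType

/-! ### Integration by parts against the kernel and its tail. -/

/-- This is the product rule for `K (T - s) * g s`, as `s ↦ K (T - s)` has derivative `β (T - s)`.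
Since `β` may be singular at `0`, `K` is differentiated only at positive times, and continuity
covers the endpoint. -/
theorem integral_kernel_sub_mul {β K : ℝ → ℝ} (hK : ContinuousOn K (Ici 0))
    (hKd : ∀ t, 0 < t → HasDerivAt K (-β t) t) (hβ : IntegrableOn β (Ioi 0))
    {T : ℝ} (hT : 0 ≤ T) {g g' : ℝ → ℝ} (hg : ContinuousOn g (Icc 0 T))
    (hgd : ∀ t ∈ Ioo 0 T, HasDerivAt g (g' t) t) (hg' : ContinuousOn g' (Icc 0 T)) :
    ∫ s in (0 : ℝ)..T, β (T - s) * g s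
      = K 0 * g T - K T * g 0 - ∫ s in (0 : ℝ)..T, K (T - s) * g' s := by
  have hβi : IntervalIntegrable β volume 0 T := by
    rw [intervalIntegrable_iff_integrableOn_Ioc_of_le hT]
    exact hβ.mono_set Ioc_subset_Ioi_self
  have hβs : IntervalIntegrable (fun s => β (T - s)) volume 0 T := by
    simpa using (hβi.comp_sub_left T).symm
  have hKs : ContinuousOn (fun s => K (T - s)) (Icc 0 T) :=
    hK.comp (by fun_prop) fun s hs => by simpa using hs.2
  have h1 : IntervalIntegrable (fun s => β (T - s) * g s) volume 0 T :=
    hβs.mul_continuousOn (by rwa [uIcc_of_le hT])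
  have h2 : IntervalIntegrable (fun s => K (T - s) * g' s) volume 0 T :=
    ContinuousOn.intervalIntegrable (by rw [uIcc_of_le hT]; exact hKs.mul hg')
  have h3 := intervalIntegral.integral_eq_sub_of_hasDerivAt_of_le (f := fun s => K (T - s) * g s)
    (f' := fun s => β (T - s) * g s + K (T - s) * g' s) hT (hKs.mul hg) (fun s hs => by
      have hd := ((hKd (T - s) (by linarith [hs.2])).comp s ((hasDerivAt_id s).const_sub T)).mul
        (hgd s hs)
      refine hd.congr_deriv ?_
      simp only [Function.comp_apply]
      ring) (h1.add h2)
  rw [intervalIntegral.integral_add h1 h2] at h3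
  simp only [sub_self, sub_zero] at h3
  linarith

/-- The product rule for `K * g`. It moves the time derivative off `w'` in the term carrying the
initial value `w 0`, where no bound on `w'` is available. -/
theorem integral_kernel_mul_deriv {β K : ℝ → ℝ} (hK : ContinuousOn K (Ici 0))
    (hKd : ∀ t, 0 < t → HasDerivAt K (-β t) t) (hβ : IntegrableOn β (Ioi 0))
    {T : ℝ} (hT : 0 ≤ T) {g g' : ℝ → ℝ} (hg : ContinuousOn g (Icc 0 T))
    (hgd : ∀ t ∈ Ioo 0 T, HasDerivAt g (g' t) t) (hg' : ContinuousOn g' (Icc 0 T)) :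
    ∫ s in (0 : ℝ)..T, K s * g' s
      = K T * g T - K 0 * g 0 + ∫ s in (0 : ℝ)..T, β s * g s := by
  have hβi : IntervalIntegrable β volume 0 T := by
    rw [intervalIntegrable_iff_integrableOn_Ioc_of_le hT]
    exact hβ.mono_set Ioc_subset_Ioi_self
  have hKs : ContinuousOn K (Icc 0 T) := hK.mono Icc_subset_Ici_self
  have h1 : IntervalIntegrable (fun s => -β s * g s) volume 0 T :=
    hβi.neg.mul_continuousOn (by rwa [uIcc_of_le hT])
  have h2 : IntervalIntegrable (fun s => K s * g' s) volume 0 T :=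
    ContinuousOn.intervalIntegrable (by rw [uIcc_of_le hT]; exact hKs.mul hg')
  have h3 := intervalIntegral.integral_eq_sub_of_hasDerivAt_of_le (f := fun s => K s * g s)
    (f' := fun s => -β s * g s + K s * g' s) hT (hKs.mul hg) (fun s hs =>
      (hKd s hs.1).mul (hgd s hs)) (h1.add h2)
  rw [intervalIntegral.integral_add h1 h2] at h3
  simp only [neg_mul, intervalIntegral.integral_neg] at h3
  linarith

theorem integrableOn_integral_triangle {T : ℝ} {F : ℝ → ℝ → ℝ}
    (hF : Integrable (fun z : ℝ × ℝ => F z.1 z.2)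
      ((volume.restrict (Ioc 0 T)).prod (volume.restrict (Ioc 0 T)))) :
    IntegrableOn (fun t => ∫ s in (0 : ℝ)..t, F t s) (Ioc 0 T) := by
  have hD : MeasurableSet {z : ℝ × ℝ | z.2 ≤ z.1} := measurableSet_le measurable_snd measurable_fst
  refine (hF.indicator hD).integral_prod_left.congr ?_
  filter_upwards [ae_restrict_mem measurableSet_Ioc] with t ht
  have e : Ioc 0 t = Ioc 0 T ∩ Iic t := by
    ext s; simp only [mem_Ioc, mem_inter_iff, mem_Iic]
    exact ⟨fun h => ⟨⟨h.1, h.2.trans ht.2⟩, h.2⟩, fun h => ⟨h.1.1, h.2⟩⟩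
  rw [intervalIntegral.integral_of_le ht.1.le, e, inter_comm, ← Measure.restrict_restrict
    measurableSet_Iic, ← integral_indicator measurableSet_Iic]
  rfl

/-! ### Energy estimates without Gronwall. -/

section Energy

variable {H₁ H₂ : Type*} [NormedAddCommGroup H₁] [InnerProductSpace ℝ H₁] [CompleteSpace H₁]
  [NormedAddCommGroup H₂] [InnerProductSpace ℝ H₂]

/-- The integrated energy inequality of a wave equation with memory kernel `β`, whose tail `K` is of
positive type. -/
theorem energy_le_of_positive_type {β K : ℝ → ℝ} {m : ℝ} (hm : m ≤ 1)
    (hK : ContinuousOn K (Ici 0)) (hKd : ∀ t, 0 < t → HasDerivAt K (-β t) t)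
    (hβ : IntegrableOn β (Ioi 0)) (hβm : ∫ s in Ioi 0, |β s| ≤ m) (hKm : ∀ t, 0 ≤ t → |K t| ≤ m)
    (hpos : ∀ T, 0 ≤ T → ∀ φ : ℝ → H₂, IntegrableOn φ (Ioc 0 T) →
      0 ≤ ∫ t in (0 : ℝ)..T, ∫ s in (0 : ℝ)..t, K (t - s) * inner ℝ (φ s) (φ t))
    {T : ℝ} (hT : 0 ≤ T) {p p' : ℝ → H₁} {w w' : ℝ → H₂} {F : ℝ → ℝ}
    (hp' : IntervalIntegrable p' volume 0 T)
    (hp : ∀ t ∈ Icc 0 T, p t = p 0 + ∫ s in (0 : ℝ)..t, p' s)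
    (hw : ∀ t ∈ Icc 0 T, HasDerivWithinAt w (w' t) (Icc 0 T) t) (hw' : ContinuousOn w' (Icc 0 T))
    (hF : IntervalIntegrable F volume 0 T) (hF0 : ∀ t, 0 ≤ F t)
    (hineq : ∀ᵐ t ∂(volume.restrict (Ioc 0 T)),
      inner ℝ (p' t) (p t) + inner ℝ (w t) (w' t)
        - ∫ s in (0 : ℝ)..t, β (t - s) * inner ℝ (w s) (w' t) ≤ F t * ‖p t‖)
    {P W : ℝ} (hP : ∀ t ∈ Icc 0 T, ‖p t‖ ≤ P) (hW : ∀ t ∈ Icc 0 T, ‖w t‖ ≤ W) :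
    ‖p T‖ ^ 2 + (1 - K 0) * ‖w T‖ ^ 2
      ≤ ‖p 0‖ ^ 2 + (1 - K 0) * ‖w 0‖ ^ 2 + 2 * P * (∫ t in (0 : ℝ)..T, F t)
        + 6 * ‖w 0‖ * W := by
  have hwc : ContinuousOn w (Icc 0 T) := fun t ht => (hw t ht).continuousWithinAt
  have hwd : ∀ t ∈ Ioo 0 T, HasDerivAt w (w' t) t := fun t ht =>
    (hw t (Ioo_subset_Icc_self ht)).hasDerivAt (Icc_mem_nhds ht.1 ht.2)
  have hp'i : IntegrableOn p' (Ioc 0 T) := (intervalIntegrable_iff_integrableOn_Ioc_of_le hT).1 hp'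
  have hpc : ContinuousOn p (Icc 0 T) := by
    have : ContinuousOn (fun t => ∫ s in (0 : ℝ)..t, p' s) (uIcc 0 T) :=
      intervalIntegral.continuousOn_primitive_interval
        (by rw [uIcc_of_le hT]; exact (integrableOn_Icc_iff_integrableOn_Ioc).2 hp'i)
    rw [uIcc_of_le hT] at this
    exact (continuousOn_const.add this).congr hp
  have hpm : AEStronglyMeasurable p (volume.restrict (Ioc 0 T)) :=
    (hpc.mono Ioc_subset_Icc_self).aestronglyMeasurable measurableSet_Ioc
  have hm0 : 0 ≤ m := (abs_nonneg _).trans (hKm 0 le_rfl)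
  have hW0 : 0 ≤ W := (norm_nonneg _).trans (hW 0 ⟨le_rfl, hT⟩)
  -- integrability of the five terms
  have i1 : IntervalIntegrable (fun t => (inner ℝ (p' t) (p t) : ℝ)) volume 0 T := by
    rw [intervalIntegrable_iff_integrableOn_Ioc_of_le hT]
    refine Integrable.mono' (hp'i.norm.mul_const P) (hp'i.aestronglyMeasurable.inner hpm) ?_
    filter_upwards [ae_restrict_mem measurableSet_Ioc] with t ht
    refine (norm_inner_le_norm _ _).trans ?_
    gcongr
    exact hP t (Ioc_subset_Icc_self ht)
  have i2 : IntervalIntegrable (fun t => (inner ℝ (w t) (w' t) : ℝ)) volume 0 T :=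
    ContinuousOn.intervalIntegrable (by rw [uIcc_of_le hT]; exact hwc.inner hw')
  have c3 : ContinuousOn (fun t => (inner ℝ (w 0) (w' t) : ℝ)) (Icc 0 T) :=
    continuousOn_const.inner hw'
  have i3 : IntervalIntegrable (fun t => K t * (inner ℝ (w 0) (w' t) : ℝ)) volume 0 T :=
    ContinuousOn.intervalIntegrable
      (by rw [uIcc_of_le hT]; exact (hK.mono Icc_subset_Ici_self).mul c3)
  have hw'i : IntegrableOn w' (Ioc 0 T) :=
    (hw'.integrableOn_compact isCompact_Icc).mono_set Ioc_subset_Icc_self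
  have i4 : IntervalIntegrable
      (fun t => ∫ s in (0 : ℝ)..t, K (t - s) * inner ℝ (w' s) (w' t)) volume 0 T := by
    rw [intervalIntegrable_iff_integrableOn_Ioc_of_le hT]
    have hKc : Continuous fun t => K |t| :=
      hK.comp_continuous continuous_abs fun t => abs_nonneg t
    have : Integrable (fun z : ℝ × ℝ => K |z.1 - z.2| * (inner ℝ (w' z.1) (w' z.2) : ℝ))
        ((volume.restrict (Ioc 0 T)).prod (volume.restrict (Ioc 0 T))) :=
      (integrable_inner_prod hw'i hw'i).bdd_mul (c := m)
        (hKc.comp (continuous_fst.sub continuous_snd)).aestronglyMeasurable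
        (Filter.Eventually.of_forall fun z => hKm _ (abs_nonneg _))
    refine (integrableOn_integral_triangle
      (F := fun t s => K |t - s| * (inner ℝ (w' t) (w' s) : ℝ)) this).congr_fun
      (fun t ht => ?_) measurableSet_Ioc
    refine intervalIntegral.integral_congr fun s hs => ?_
    rw [uIcc_of_le ht.1.le] at hs
    simp only [abs_of_nonneg (sub_nonneg.2 hs.2), real_inner_comm]
  have i5 : IntervalIntegrable (fun t => F t * ‖p t‖) volume 0 T :=
    hF.mul_continuousOn (by rw [uIcc_of_le hT]; exact hpc.norm)
  -- the memory term
  have hmem : ∀ t ∈ Ioc 0 T, ∫ s in (0 : ℝ)..t, β (t - s) * inner ℝ (w s) (w' t)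
      = K 0 * inner ℝ (w t) (w' t) - K t * inner ℝ (w 0) (w' t)
        - ∫ s in (0 : ℝ)..t, K (t - s) * inner ℝ (w' s) (w' t) := by
    intro t ht
    have hs : Icc 0 t ⊆ Icc 0 T := Icc_subset_Icc_right ht.2
    refine integral_kernel_sub_mul hK hKd hβ ht.1.le ((hwc.mono hs).inner continuousOn_const)
      (fun s hs' => ?_) ((hw'.mono hs).inner continuousOn_const)
    simpa using (hwd s ⟨hs'.1, hs'.2.trans_le ht.2⟩).inner ℝ (hasDerivAt_const s (w' t))
  have hle : ∀ᵐ t ∂(volume.restrict (Ioc 0 T)),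
      (inner ℝ (p' t) (p t) + (1 - K 0) * inner ℝ (w t) (w' t) + K t * inner ℝ (w 0) (w' t))
        + ∫ s in (0 : ℝ)..t, K (t - s) * inner ℝ (w' s) (w' t) ≤ F t * ‖p t‖ := by
    filter_upwards [hineq, ae_restrict_mem measurableSet_Ioc] with t h1 h2
    rw [hmem t h2] at h1
    linarith
  have i12 := (i1.add (i2.const_mul (1 - K 0))).add i3
  have h1 := intervalIntegral.integral_mono_ae_restrict hT (i12.add i4) i5
    (by rw [← restrict_Ioc_eq_restrict_Icc]; exact hle)
  rw [intervalIntegral.integral_add i12 i4,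
    intervalIntegral.integral_add (i1.add (i2.const_mul (1 - K 0))) i3,
    intervalIntegral.integral_add i1 (i2.const_mul (1 - K 0)),
    intervalIntegral.integral_const_mul] at h1
  have h2 := hpos T hT w' hw'i
  have h3 := integral_inner_of_eq_integral hT hp' hp
  have h4 : 2 * ∫ t in (0 : ℝ)..T, (inner ℝ (w t) (w' t) : ℝ) = ‖w T‖ ^ 2 - ‖w 0‖ ^ 2 := by
    have h := intervalIntegral.integral_eq_sub_of_hasDerivAt_of_le (f := fun s => ‖w s‖ ^ 2)
      (f' := fun s => 2 * (inner ℝ (w s) (w' s) : ℝ)) hT (hwc.norm.pow 2)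
      (fun s hs => (hwd s hs).norm_sq) (i2.const_mul 2)
    rw [intervalIntegral.integral_const_mul] at h
    exact h
  -- The term with `w 0` becomes two boundary terms and an integral against `β`. Each is at most `‖w
  -- 0‖ * W`, because `|K|` and the mass of `β` are at most `1`; three such terms, doubled, give the
  -- constant `6`.
  have h5 := integral_kernel_mul_deriv hK hKd hβ hT
    (g := fun t => (inner ℝ (w 0) (w t) : ℝ)) (g' := fun t => (inner ℝ (w 0) (w' t) : ℝ))
    (continuousOn_const.inner hwc)
    (fun s hs => by simpa using (hasDerivAt_const s (w 0)).inner ℝ (hwd s hs)) c3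
  have b0 : ∀ t ∈ Icc 0 T, |(inner ℝ (w 0) (w t) : ℝ)| ≤ ‖w 0‖ * W := fun t ht =>
    (abs_real_inner_le_norm _ _).trans (by gcongr; exact hW t ht)
  have b1 : ∀ t ∈ Icc 0 T, |K t * (inner ℝ (w 0) (w t) : ℝ)| ≤ ‖w 0‖ * W := by
    intro t ht
    rw [abs_mul]
    calc |K t| * |(inner ℝ (w 0) (w t) : ℝ)| ≤ 1 * (‖w 0‖ * W) := by
          gcongr
          · exact (hKm t ht.1).trans hm
          · exact b0 t ht
      _ = _ := one_mul _
  have b2 : |∫ s in (0 : ℝ)..T, β s * (inner ℝ (w 0) (w s) : ℝ)| ≤ ‖w 0‖ * W := by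
    have hβT : IntegrableOn β (Ioc 0 T) := hβ.mono_set Ioc_subset_Ioi_self
    have hβi : IntervalIntegrable (fun s => |β s| * (‖w 0‖ * W)) volume 0 T := by
      rw [intervalIntegrable_iff_integrableOn_Ioc_of_le hT]
      exact hβT.norm.mul_const _
    calc |∫ s in (0 : ℝ)..T, β s * (inner ℝ (w 0) (w s) : ℝ)|
        ≤ ∫ s in (0 : ℝ)..T, |β s| * (‖w 0‖ * W) := by
          rw [← Real.norm_eq_abs]
          refine intervalIntegral.norm_integral_le_of_norm_le hT
            (Filter.Eventually.of_forall fun s hs => ?_) hβi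
          rw [Real.norm_eq_abs, abs_mul]
          gcongr
          exact b0 s (Ioc_subset_Icc_self hs)
      _ = (∫ s in Ioc 0 T, |β s|) * (‖w 0‖ * W) := by
          rw [intervalIntegral.integral_mul_const, intervalIntegral.integral_of_le hT]
      _ ≤ 1 * (‖w 0‖ * W) := by
          gcongr
          refine le_trans ?_ (hβm.trans hm)
          exact setIntegral_mono_set (f := fun s => |β s|) hβ.norm (Filter.Eventually.of_forall fun s => abs_nonneg _)
            (Filter.Eventually.of_forall Ioc_subset_Ioi_self)
      _ = _ := one_mul _
  have h6 : ∫ t in (0 : ℝ)..T, F t * ‖p t‖ ≤ P * ∫ t in (0 : ℝ)..T, F t := by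
    rw [← intervalIntegral.integral_const_mul]
    refine intervalIntegral.integral_mono_on hT i5 (hF.const_mul P) fun t ht => ?_
    rw [mul_comm]
    exact mul_le_mul_of_nonneg_right (hP t ht) (hF0 t)
  have b3 := abs_le.1 (b1 T ⟨hT, le_rfl⟩)
  have b4 := abs_le.1 (b1 0 ⟨le_rfl, hT⟩)
  have b5 := abs_le.1 b2
  have h7 := congrArg (fun x => (1 - K 0) * x) h4
  linarith [b3.1, b4.2, b5.1]

/-- The stability bound: the energy is controlled by the data with a constant that depends only
on a bound `m < 1` of the total mass of the kernel. -/
theorem norm_add_norm_le_of_positive_type {β K : ℝ → ℝ} {m : ℝ} (hm : m < 1)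
    (hK : ContinuousOn K (Ici 0)) (hKd : ∀ t, 0 < t → HasDerivAt K (-β t) t)
    (hβ : IntegrableOn β (Ioi 0)) (hβm : ∫ s in Ioi 0, |β s| ≤ m) (hKm : ∀ t, 0 ≤ t → |K t| ≤ m)
    (hpos : ∀ T, 0 ≤ T → ∀ φ : ℝ → H₂, IntegrableOn φ (Ioc 0 T) →
      0 ≤ ∫ t in (0 : ℝ)..T, ∫ s in (0 : ℝ)..t, K (t - s) * inner ℝ (φ s) (φ t))
    {T : ℝ} (hT : 0 ≤ T) {p p' : ℝ → H₁} {w w' : ℝ → H₂} {F : ℝ → ℝ}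
    (hp' : IntervalIntegrable p' volume 0 T)
    (hp : ∀ t ∈ Icc 0 T, p t = p 0 + ∫ s in (0 : ℝ)..t, p' s)
    (hw : ∀ t ∈ Icc 0 T, HasDerivWithinAt w (w' t) (Icc 0 T) t) (hw' : ContinuousOn w' (Icc 0 T))
    (hF : IntervalIntegrable F volume 0 T) (hF0 : ∀ t, 0 ≤ F t)
    (hineq : ∀ᵐ t ∂(volume.restrict (Ioc 0 T)),
      inner ℝ (p' t) (p t) + inner ℝ (w t) (w' t)
        - ∫ s in (0 : ℝ)..t, β (t - s) * inner ℝ (w s) (w' t) ≤ F t * ‖p t‖) :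
    ‖p T‖ + ‖w T‖ ≤ (1 + 1 / √(1 - m)) * (8 / √(1 - m))
      * (‖p 0‖ + ‖w 0‖ + ∫ t in (0 : ℝ)..T, F t) := by
  have hm0 : 0 ≤ m := (abs_nonneg _).trans (hKm 0 le_rfl)
  have hwc : ContinuousOn w (Icc 0 T) := fun t ht => (hw t ht).continuousWithinAt
  have hpc : ContinuousOn p (Icc 0 T) := by
    have : ContinuousOn (fun t => ∫ s in (0 : ℝ)..t, p' s) (uIcc 0 T) :=
      intervalIntegral.continuousOn_primitive_interval
        (by rw [uIcc_of_le hT]; exact (integrableOn_Icc_iff_integrableOn_Ioc).2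
              ((intervalIntegrable_iff_integrableOn_Ioc_of_le hT).1 hp'))
    rw [uIcc_of_le hT] at this
    exact (continuousOn_const.add this).congr hp
  obtain ⟨r, hr⟩ : ∃ r, r = √(1 - m) := ⟨_, rfl⟩
  have hr0 : 0 < r := by rw [hr]; exact Real.sqrt_pos.2 (by linarith)
  have hr2 : r ^ 2 = 1 - m := by rw [hr]; exact Real.sq_sqrt (by linarith)
  have hr1 : r ≤ 1 := by nlinarith
  rw [← hr]
  have hK0 := abs_le.1 (hKm 0 le_rfl)
  have hc1 : r ^ 2 ≤ 1 - K 0 := by linarith [hK0.2]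
  have hc2 : 1 - K 0 ≤ 2 := by linarith [hK0.1]
  have hEc : ContinuousOn (fun t => ‖p t‖ ^ 2 + (1 - K 0) * ‖w t‖ ^ 2) (Icc 0 T) :=
    (hpc.norm.pow 2).add (continuousOn_const.mul (hwc.norm.pow 2))
  -- The energy inequality is used on `[0, τ]`, with `τ` a time of maximal energy `X ^ 2`; the a
  -- priori bounds there are `P = X` and `W = X / r`.
  obtain ⟨τ, hτ, hmax⟩ := isCompact_Icc.exists_isMaxOn ⟨0, ⟨le_rfl, hT⟩⟩ hEc
  obtain ⟨X, hX⟩ : ∃ X, X = √(‖p τ‖ ^ 2 + (1 - K 0) * ‖w τ‖ ^ 2) := ⟨_, rfl⟩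
  have hE0 : 0 ≤ ‖p τ‖ ^ 2 + (1 - K 0) * ‖w τ‖ ^ 2 :=
    add_nonneg (sq_nonneg _) (mul_nonneg ((sq_nonneg r).trans hc1) (sq_nonneg _))
  have hX0 : 0 ≤ X := hX ▸ Real.sqrt_nonneg _
  have hX2 : X ^ 2 = ‖p τ‖ ^ 2 + (1 - K 0) * ‖w τ‖ ^ 2 := by rw [hX]; exact Real.sq_sqrt hE0
  have hE : ∀ t ∈ Icc 0 T, ‖p t‖ ^ 2 + (1 - K 0) * ‖w t‖ ^ 2 ≤ X ^ 2 := fun t ht => by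
    rw [hX2]; exact hmax ht
  have hP : ∀ t ∈ Icc 0 T, ‖p t‖ ≤ X := fun t ht => by
    refine abs_le_of_sq_le_sq' ?_ hX0 |>.2
    nlinarith [hE t ht, mul_nonneg ((sq_nonneg r).trans hc1) (sq_nonneg ‖w t‖)]
  have hW : ∀ t ∈ Icc 0 T, ‖w t‖ ≤ X / r := fun t ht => by
    rw [le_div_iff₀ hr0]
    refine abs_le_of_sq_le_sq' ?_ hX0 |>.2
    nlinarith [hE t ht, mul_le_mul_of_nonneg_right hc1 (sq_nonneg ‖w t‖), sq_nonneg ‖p t‖]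
  have hs : Icc 0 τ ⊆ Icc 0 T := Icc_subset_Icc_right hτ.2
  have hu : uIcc 0 τ ⊆ uIcc 0 T := by rwa [uIcc_of_le hτ.1, uIcc_of_le hT]
  have key := energy_le_of_positive_type hm.le hK hKd hβ hβm hKm hpos hτ.1 (p := p) (p' := p')
    (w := w) (w' := w') (F := F) (hp'.mono_set hu) (fun t ht => hp t (hs ht))
    (fun t ht => (hw t (hs ht)).mono hs) (hw'.mono hs) (hF.mono_set hu) hF0
    (ae_restrict_of_ae_restrict_of_subset (Ioc_subset_Ioc_right hτ.2) hineq)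
    (fun t ht => hP t (hs ht)) (fun t ht => hW t (hs ht))
  have hFm : ∫ t in (0 : ℝ)..τ, F t ≤ ∫ t in (0 : ℝ)..T, F t :=
    intervalIntegral.integral_mono_interval le_rfl hτ.1 hτ.2
      (Filter.Eventually.of_forall hF0) hF
  have hFn : 0 ≤ ∫ t in (0 : ℝ)..T, F t := intervalIntegral.integral_nonneg hT fun t _ => hF0 t
  have hz : (0 : ℝ) ∈ Icc 0 T := ⟨le_rfl, hT⟩
  -- One factor `‖w 0‖` is traded for `X / r` so that every term becomes linear in `X`; this `2` and
  -- the earlier `6` make the `8` of the final constant.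
  have hw0 : (1 - K 0) * ‖w 0‖ ^ 2 ≤ 2 * ‖w 0‖ * (X / r) := by
    calc (1 - K 0) * ‖w 0‖ ^ 2 ≤ 2 * ‖w 0‖ ^ 2 := by gcongr
      _ = 2 * ‖w 0‖ * ‖w 0‖ := by ring
      _ ≤ _ := by gcongr; exact hW 0 hz
  have hXX : X * X ≤ X * (‖p 0‖ + 8 / r * ‖w 0‖ + 2 * ∫ t in (0 : ℝ)..T, F t) := by
    have e : X * (‖p 0‖ + 8 / r * ‖w 0‖ + 2 * ∫ t in (0 : ℝ)..T, F t)
        = ‖p 0‖ * X + 2 * ‖w 0‖ * (X / r) + 2 * X * (∫ t in (0 : ℝ)..T, F t)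
          + 6 * ‖w 0‖ * (X / r) := by ring
    rw [e]
    have h1 : ‖p 0‖ ^ 2 ≤ ‖p 0‖ * X := by
      rw [pow_two]; gcongr; exact hP 0 hz
    have h2 := mul_le_mul_of_nonneg_left hFm (mul_nonneg zero_le_two hX0)
    rw [← hX2] at key
    linarith [pow_two X]
  have h8 : 8 ≤ 8 / r := by rw [le_div_iff₀ hr0]; linarith
  have hXle : X ≤ 8 / r * (‖p 0‖ + ‖w 0‖ + ∫ t in (0 : ℝ)..T, F t) := by
    have h1 : ‖p 0‖ ≤ 8 / r * ‖p 0‖ := le_mul_of_one_le_left (norm_nonneg _) (by linarith)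
    have h2 : 2 * (∫ t in (0 : ℝ)..T, F t) ≤ 8 / r * ∫ t in (0 : ℝ)..T, F t :=
      mul_le_mul_of_nonneg_right (by linarith) hFn
    rcases hX0.eq_or_lt with h | h
    · rw [← h]; positivity
    · have := le_of_mul_le_mul_left hXX h
      linarith
  have hfin : ‖p T‖ + ‖w T‖ ≤ (1 + 1 / r) * X := by
    have := hP T ⟨hT, le_rfl⟩
    have := hW T ⟨hT, le_rfl⟩
    have e : (1 + 1 / r) * X = X + X / r := by ring
    linarith
  refine hfin.trans ?_
  rw [mul_assoc]
  gcongr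

end Energy

/-! ### Cosine transforms and the Fourier representation of the tail. -/

theorem integrable_comp_abs_of_integrableOn_Ioi {f : ℝ → ℝ} (hf : IntegrableOn f (Ioi 0)) :
    Integrable fun x => f |x| := by
  have h1 : IntegrableOn (fun x => f |x|) (Ioi 0) :=
    hf.congr_fun (fun x hx => by simp only [abs_of_pos (mem_Ioi.1 hx)]) measurableSet_Ioi
  have h2 : IntegrableOn (fun x => f |x|) (Iic 0) := by
    rw [← Measure.map_neg_eq_self (volume : Measure ℝ)]
    let m : MeasurableEmbedding fun x : ℝ => -x := (Homeomorph.neg ℝ).measurableEmbedding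
    rw [m.integrableOn_map_iff]
    simp_rw [Function.comp_def, abs_neg, neg_preimage, neg_Iic, neg_zero]
    exact (integrableOn_Ici_iff_integrableOn_Ioi (by finiteness)).2 h1
  rw [← integrableOn_univ, ← Iic_union_Ioi (a := (0 : ℝ))]
  exact h2.union h1

theorem integrable_cos_mul {g : ℝ → ℝ} (hg : Integrable g) (c : ℝ) :
    Integrable fun v => Real.cos (c * v) * g v :=
  hg.bdd_mul (c := 1) (Continuous.aestronglyMeasurable (by fun_prop))
    (Filter.Eventually.of_forall fun q => by simpa using Real.abs_cos_le_one _)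

theorem integrable_sin_mul {g : ℝ → ℝ} (hg : Integrable g) (c : ℝ) :
    Integrable fun v => Real.sin (c * v) * g v :=
  hg.bdd_mul (c := 1) (Continuous.aestronglyMeasurable (by fun_prop))
    (Filter.Eventually.of_forall fun q => by simpa using Real.abs_sin_le_one _)

theorem integral_exp_mul_I_smul {g : ℝ → ℝ} (hg : Integrable g) (c : ℝ) :
    ∫ v : ℝ, Complex.exp (((c * v : ℝ) : ℂ) * Complex.I) • ((g v : ℝ) : ℂ)
      = ((∫ v, Real.cos (c * v) * g v : ℝ) : ℂ)
        + ((∫ v, Real.sin (c * v) * g v : ℝ) : ℂ) * Complex.I := by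
  rw [← integral_complex_ofReal, ← integral_complex_ofReal, ← integral_mul_const, ← integral_add]
  · refine integral_congr_ae (Filter.Eventually.of_forall fun v => ?_)
    simp only [Complex.exp_mul_I, smul_eq_mul]
    push_cast
    ring
  · exact (integrable_cos_mul hg c).ofReal
  · exact (integrable_sin_mul hg c).ofReal.mul_const _

/-- Fourier inversion for even real functions, in terms of cosine transforms. -/
theorem eq_integral_cosTransform {k : ℝ → ℝ} (hk : Continuous k) (hki : Integrable k)
    (heven : ∀ t, k (-t) = k t)
    (hR : Integrable fun ξ => ∫ v, Real.cos (2 * Real.pi * ξ * v) * k v) (t : ℝ) :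
    k t = ∫ ξ, (∫ v, Real.cos (2 * Real.pi * ξ * v) * k v) * Real.cos (2 * Real.pi * ξ * t) := by
  set R : ℝ → ℝ := fun ξ => ∫ v, Real.cos (2 * Real.pi * ξ * v) * k v with hRdef
  have hF : FourierTransform.fourier (fun t => ((k t : ℝ) : ℂ)) = fun ξ => ((R ξ : ℝ) : ℂ) := by
    ext ξ
    rw [Real.fourier_real_eq_integral_exp_smul]
    have e : ∀ v : ℝ, -2 * Real.pi * v * ξ = -(2 * Real.pi * ξ) * v := fun v => by ring
    simp_rw [e]
    rw [integral_exp_mul_I_smul hki]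
    -- Evenness of `k` kills the sine part, so the complex Fourier transform is the real cosine
    -- transform.
    have hodd : ∫ v, Real.sin (-(2 * Real.pi * ξ) * v) * k v = 0 := by
      have h := integral_neg_eq_self (fun v => Real.sin (-(2 * Real.pi * ξ) * v) * k v) volume
      have h' : ∀ v, Real.sin (-(2 * Real.pi * ξ) * -v) * k (-v)
          = -(Real.sin (-(2 * Real.pi * ξ) * v) * k v) := fun v => by
        rw [heven, mul_neg, Real.sin_neg, neg_mul]
      simp_rw [h'] at h
      rw [integral_neg] at h
      linarith
    rw [hodd, hRdef]
    simp [neg_mul, Real.cos_neg]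
  have hinv := congrFun (Continuous.fourierInv_fourier_eq (f := fun t => ((k t : ℝ) : ℂ))
    (by fun_prop) hki.ofReal (by rw [hF]; exact hR.ofReal)) t
  rw [hF, Real.fourierInv_eq'] at hinv
  have e : ∀ v : ℝ, 2 * Real.pi * inner ℝ v t = (2 * Real.pi * t) * v := fun v => by
    simp only [RCLike.inner_apply, conj_trivial]; ring
  simp_rw [e] at hinv
  rw [integral_exp_mul_I_smul hR] at hinv
  have := congrArg Complex.re hinv
  simp only [Complex.add_re, Complex.ofReal_re, Complex.mul_re, Complex.I_re, mul_zero,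
    Complex.ofReal_im, zero_mul, sub_zero, add_zero] at this
  rw [← this]
  refine integral_congr_ae (Filter.Eventually.of_forall fun ξ => ?_)
  simp only
  rw [mul_comm]
  congr 2
  ring

/-- Integrate by parts with the antiderivative `sin (η t) / η` of the cosine. The boundary terms
vanish: at `0` because the sine does, at infinity because `K` decays exponentially. -/
theorem integral_cos_mul_tail {β K : ℝ → ℝ} (hK : ContinuousOn K (Ici 0))
    (hKd : ∀ t, 0 < t → HasDerivAt K (-β t) t) (hβ : IntegrableOn β (Ioi 0))
    {M : ℝ} (hKM : ∀ t, 0 ≤ t → |K t| ≤ M * Real.exp (-t))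
    (hKi : IntegrableOn K (Ioi 0)) {η : ℝ} (hη : η ≠ 0) :
    ∫ t in Ioi 0, Real.cos (η * t) * K t = (∫ t in Ioi 0, β t * Real.sin (η * t)) / η := by
  have hv : ∀ x ∈ Ioi (0 : ℝ), HasDerivAt (fun t => Real.sin (η * t) / η) (Real.cos (η * x)) x := by
    intro x _
    have h := (((hasDerivAt_id x).const_mul η).sin).div_const η
    refine h.congr_deriv ?_
    simp only [id]
    field_simp
  have i1 : IntegrableOn (K * fun t => Real.cos (η * t)) (Ioi 0) :=
    Integrable.mul_bdd (c := 1) hKi (Continuous.aestronglyMeasurable (by fun_prop))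
      (Filter.Eventually.of_forall fun q => by simpa using Real.abs_cos_le_one _)
  have i2 : IntegrableOn (fun t => β t * Real.sin (η * t)) (Ioi 0) :=
    Integrable.mul_bdd (c := 1) hβ (Continuous.aestronglyMeasurable (by fun_prop))
      (Filter.Eventually.of_forall fun q => by simpa using Real.abs_sin_le_one _)
  have i3 : IntegrableOn ((fun t => -β t) * fun t => Real.sin (η * t) / η) (Ioi 0) := by
    refine (i2.neg.div_const η).congr (Filter.Eventually.of_forall fun t => ?_)
    simp only [Pi.neg_apply, Pi.mul_apply]; ring
  have t1 : Filter.Tendsto (K * fun t => Real.sin (η * t) / η) (𝓝[>] 0) (𝓝 0) := by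
    have hc : ContinuousWithinAt (K * fun t => Real.sin (η * t) / η) (Ioi 0) 0 :=
      ((hK 0 self_mem_Ici).mono Ioi_subset_Ici_self).mul
        (Continuous.continuousWithinAt (by fun_prop))
    simpa [ContinuousWithinAt] using hc
  have t2 : Filter.Tendsto (K * fun t => Real.sin (η * t) / η) Filter.atTop (𝓝 0) := by
    have hM : Filter.Tendsto (fun t => M * Real.exp (-t) * (1 / |η|)) Filter.atTop (𝓝 0) := by
      simpa using (Real.tendsto_exp_neg_atTop_nhds_zero.const_mul M).mul_const (1 / |η|)
    refine squeeze_zero_norm' ?_ hM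
    filter_upwards [Filter.eventually_ge_atTop 0] with t ht
    rw [Pi.mul_apply, norm_mul, Real.norm_eq_abs, Real.norm_eq_abs, abs_div]
    have h := hKM t ht
    have := (abs_nonneg _).trans h
    gcongr
    exact Real.abs_sin_le_one _
  have h := integral_Ioi_mul_deriv_eq_deriv_mul (fun x hx => hKd x hx) hv i1 i3 t1 t2
  simp_rw [mul_comm (Real.cos _) (K _)]
  rw [h, ← integral_div, sub_zero, zero_sub, ← integral_neg]
  refine integral_congr_ae (Filter.Eventually.of_forall fun t => ?_)
  simp only; ring

/-- The tail of a kernel with nonnegative, slowly decaying sine transform is a superposition of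
cosines with a nonnegative density. -/
theorem exists_cos_density_of_sineTransform_nonneg {β K : ℝ → ℝ} (hK : ContinuousOn K (Ici 0))
    (hKd : ∀ t, 0 < t → HasDerivAt K (-β t) t) (hβ : IntegrableOn β (Ioi 0))
    {M : ℝ} (hKM : ∀ t, 0 ≤ t → |K t| ≤ M * Real.exp (-t))
    (hS : ∀ η, 0 < η → 0 ≤ ∫ t in Ioi 0, β t * Real.sin (η * t))
    {C R₀ : ℝ} (hR₀ : 0 < R₀)
    (hdec : ∀ η, R₀ ≤ η → ∫ t in Ioi 0, β t * Real.sin (η * t) ≤ C * η ^ (-(1 / 2) : ℝ)) :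
    ∃ R : ℝ → ℝ, Integrable R ∧ (∀ ξ, 0 ≤ R ξ) ∧
      ∀ t, 0 ≤ t → K t = ∫ ξ, R ξ * Real.cos (2 * Real.pi * ξ * t) := by
  have hkc : Continuous fun t => K |t| := hK.comp_continuous continuous_abs fun t => abs_nonneg t
  have hKi : IntegrableOn K (Ioi 0) := by
    have hexp : IntegrableOn (fun t : ℝ => M * Real.exp (-t)) (Ioi 0) :=
      (integrableOn_exp_neg_Ioi 0).const_mul M
    refine Integrable.mono' hexp ((hK.mono Ioi_subset_Ici_self).aestronglyMeasurable
      measurableSet_Ioi) ?_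
    filter_upwards [ae_restrict_mem measurableSet_Ioi] with t ht using hKM t (le_of_lt ht)
  have hki : Integrable fun t => K |t| := integrable_comp_abs_of_integrableOn_Ioi hKi
  set R : ℝ → ℝ := fun ξ => ∫ v, Real.cos (2 * Real.pi * ξ * v) * K |v| with hRdef
  have hRc : Continuous R := by
    refine continuous_of_dominated (bound := fun v => ‖K |v|‖)
      (fun ξ => (integrable_cos_mul hki _).aestronglyMeasurable) (fun ξ => ?_) hki.norm ?_
    · refine Filter.Eventually.of_forall fun v => ?_
      rw [norm_mul]
      exact mul_le_of_le_one_left (norm_nonneg _) (by simpa using Real.abs_cos_le_one _)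
    · exact Filter.Eventually.of_forall fun v => by fun_prop
  have hReven : ∀ ξ, R |ξ| = R ξ := by
    intro ξ
    rcases abs_choice ξ with h | h <;> rw [h]
    simp [hRdef]
  have hRpos : ∀ ξ, 0 < ξ → R ξ
      = 2 * ((∫ t in Ioi 0, β t * Real.sin (2 * Real.pi * ξ * t)) / (2 * Real.pi * ξ)) := by
    intro ξ hξ
    rw [← integral_cos_mul_tail hK hKd hβ hKM hKi (by positivity),
      ← integral_comp_abs (f := fun v => Real.cos (2 * Real.pi * ξ * v) * K v)]
    refine integral_congr_ae (Filter.Eventually.of_forall fun v => ?_)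
    rcases abs_choice v with h | h <;> simp only [h]
    rw [mul_neg, Real.cos_neg]
  have hRnn' : ∀ ξ, 0 < ξ → 0 ≤ R ξ := fun ξ hξ => by
    have := hS (2 * Real.pi * ξ) (by positivity)
    rw [hRpos ξ hξ]; positivity
  -- The sine formula divides by the frequency, so the value at `0` is obtained by continuity.
  have hR0 : 0 ≤ R 0 := by
    refine ge_of_tendsto ((hRc.tendsto 0).mono_left nhdsWithin_le_nhds : Filter.Tendsto R (𝓝[>] 0) _) ?_
    filter_upwards [self_mem_nhdsWithin] with ξ hξ using hRnn' ξ hξ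
  have hRnn : ∀ ξ, 0 ≤ R ξ := fun ξ => by
    rw [← hReven]
    rcases (abs_nonneg ξ).eq_or_lt with h | h
    · rw [← h]; exact hR0
    · exact hRnn' _ h
  have hRi : IntegrableOn R (Ioi 0) := by
    have hsplit : Ioi (0 : ℝ) = Ioc 0 R₀ ∪ Ioi R₀ := (Ioc_union_Ioi_eq_Ioi hR₀.le).symm
    rw [hsplit]
    refine ((hRc.continuousOn.integrableOn_compact isCompact_Icc).mono_set
      Ioc_subset_Icc_self).union ?_
    -- The exponent `-3/2` combines the decay `-1/2` of the sine transform with the division by `ξ`;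
    -- this is integrable at infinity.
    have hrp : IntegrableOn (fun ξ : ℝ => 2 * |C| * ξ ^ (-(3 / 2) : ℝ)) (Ioi R₀) :=
      (integrableOn_Ioi_rpow_of_lt (by norm_num) hR₀).const_mul _
    refine Integrable.mono' hrp hRc.aestronglyMeasurable ?_
    filter_upwards [ae_restrict_mem measurableSet_Ioi] with ξ hξ
    have hξ : R₀ < ξ := hξ
    have hξ0 : 0 < ξ := hR₀.trans hξ
    have hπ : ξ ≤ 2 * Real.pi * ξ := by nlinarith [Real.pi_gt_three]
    rw [Real.norm_of_nonneg (hRnn ξ), hRpos ξ hξ0]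
    have h1 := hdec (2 * Real.pi * ξ) (by linarith)
    have h2 : (2 * Real.pi * ξ) ^ (-(1 / 2) : ℝ) ≤ ξ ^ (-(1 / 2) : ℝ) :=
      Real.rpow_le_rpow_of_nonpos hξ0 hπ (by norm_num)
    have h3 : ξ ^ (-(3 / 2) : ℝ) = ξ ^ (-(1 / 2) : ℝ) / ξ := by
      rw [← Real.rpow_sub_one hξ0.ne']; norm_num
    calc 2 * ((∫ t in Ioi 0, β t * Real.sin (2 * Real.pi * ξ * t)) / (2 * Real.pi * ξ))
        ≤ 2 * ((|C| * ξ ^ (-(1 / 2) : ℝ)) / ξ) := by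
          have hp : 0 ≤ (2 * Real.pi * ξ) ^ (-(1 / 2) : ℝ) := by positivity
          gcongr
          refine h1.trans ?_
          calc C * (2 * Real.pi * ξ) ^ (-(1 / 2) : ℝ)
              ≤ |C| * (2 * Real.pi * ξ) ^ (-(1 / 2) : ℝ) := by gcongr; exact le_abs_self C
            _ ≤ _ := by gcongr
      _ = _ := by rw [h3]; ring
  have hRint : Integrable R :=
    (integrable_comp_abs_of_integrableOn_Ioi hRi).congr (Filter.Eventually.of_forall hReven)
  refine ⟨R, hRint, hRnn, fun t ht => ?_⟩
  have := eq_integral_cosTransform hkc hki (fun t => by rw [abs_neg]) hRint t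
  rwa [abs_of_nonneg ht] at this

/-! ### The tail of an integrable kernel. -/

section Tail

variable {β : ℝ → ℝ}

theorem tail_eq_sub (hβ : IntegrableOn β (Ioi 0)) {t : ℝ} (ht : 0 ≤ t) :
    ∫ s in Ioi t, β s = (∫ s in Ioi 0, β s) - ∫ s in (0 : ℝ)..t, β s := by
  rw [← intervalIntegral.integral_Ioi_sub_Ioi hβ ht]; ring

theorem continuousOn_tail (hβ : IntegrableOn β (Ioi 0)) :
    ContinuousOn (fun t => ∫ s in Ioi t, β s) (Ici 0) := by
  -- Extension by zero gives a function integrable on the whole line, whose primitive is continuous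
  -- everywhere, including at `0`.
  have hi : Integrable ((Ioi (0 : ℝ)).indicator β) := hβ.integrable_indicator measurableSet_Ioi
  have hc : Continuous fun t => ∫ s in (0 : ℝ)..t, (Ioi (0 : ℝ)).indicator β s :=
    intervalIntegral.continuous_primitive (fun _ _ => hi.intervalIntegrable) 0
  refine ((continuous_const (y := ∫ s in Ioi 0, β s)).sub hc).continuousOn.congr fun t ht => ?_
  rw [tail_eq_sub hβ ht]
  congr 1
  refine intervalIntegral.integral_congr_ae (Filter.Eventually.of_forall fun s hs => ?_)
  rw [uIoc_of_le ht] at hs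
  rw [indicator_of_mem (show s ∈ Ioi 0 from hs.1)]

theorem hasDerivAt_tail (hβ : IntegrableOn β (Ioi 0)) (hc : ContinuousOn β (Ioi 0)) {t : ℝ}
    (ht : 0 < t) : HasDerivAt (fun t => ∫ s in Ioi t, β s) (-β t) t := by
  have hi : IntervalIntegrable β volume 0 t := by
    rw [intervalIntegrable_iff_integrableOn_Ioc_of_le ht.le]
    exact hβ.mono_set Ioc_subset_Ioi_self
  have h := intervalIntegral.integral_hasDerivAt_right hi
    (hc.stronglyMeasurableAtFilter isOpen_Ioi t ht) (hc.continuousAt (Ioi_mem_nhds ht))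
  refine (h.const_sub (∫ s in Ioi 0, β s)).congr_of_eventuallyEq ?_
  filter_upwards [Ioi_mem_nhds ht] with s hs using tail_eq_sub hβ (le_of_lt hs)

theorem abs_tail_le (hβ : IntegrableOn β (Ioi 0)) {t : ℝ} (ht : 0 ≤ t) :
    |∫ s in Ioi t, β s| ≤ ∫ s in Ioi 0, |β s| :=
  (norm_integral_le_integral_norm (μ := volume.restrict (Ioi t)) β).trans
    (setIntegral_mono_set (f := fun s => |β s|) hβ.norm
      (Filter.Eventually.of_forall fun _ => abs_nonneg _)
      (Filter.Eventually.of_forall (Ioi_subset_Ioi ht)))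

end Tail

/-! ### The kernel: mass, decay and sine transform. -/

/-- The density `e^{-σs} s^{α-1} / Γ(α)`, the modulus of the kernel without the oscillation. -/
noncomputable def dampedPower (α σ s : ℝ) : ℝ := Real.exp (-σ * s) * s ^ (α - 1) / Real.Gamma α

/-- The sine transform of `dampedPower`. -/
noncomputable def dampedSine (α σ y : ℝ) : ℝ := ∫ s in Ioi 0, dampedPower α σ s * Real.sin (y * s)

theorem continuousOn_dampedPower (α σ : ℝ) : ContinuousOn (dampedPower α σ) (Ioi 0) := by
  unfold dampedPower
  refine (ContinuousOn.mul (by fun_prop) ?_).div_const _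
  exact continuousOn_id.rpow_const fun x hx => Or.inl (ne_of_gt hx)

theorem dampedPower_nonneg {α σ s : ℝ} (hα : 0 < α) (hs : 0 ≤ s) : 0 ≤ dampedPower α σ s := by
  have := Real.Gamma_pos_of_pos hα
  unfold dampedPower; positivity

theorem integrableOn_dampedPower {α σ : ℝ} (hα : 0 < α) (hσ : 0 < σ) :
    IntegrableOn (dampedPower α σ) (Ioi 0) := by
  have h := integrableOn_rpow_mul_exp_neg_mul_rpow (p := 1) (s := α - 1) (b := σ)
    (by linarith) one_pos hσ
  refine (h.div_const (Real.Gamma α)).congr (Filter.Eventually.of_forall fun s => ?_)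
  simp only [dampedPower, Real.rpow_one, mul_comm]

/-- A Gamma integral. Since `σ > 1` in the application, this mass is below `1`, which keeps the
potential energy coercive. -/
theorem integral_dampedPower {α σ : ℝ} (hα : 0 < α) (hσ : 0 < σ) :
    ∫ s in Ioi 0, dampedPower α σ s = (1 / σ) ^ α := by
  have hΓ := (Real.Gamma_pos_of_pos hα).ne'
  unfold dampedPower
  rw [integral_div]
  have h := Real.integral_rpow_mul_exp_neg_mul_Ioi hα hσ
  simp_rw [mul_comm (Real.exp _), neg_mul]
  rw [h]
  field_simp

theorem kernel_eq (α σ γ s : ℝ) :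
    HypInteg.kernel α σ γ s = dampedPower α σ s * Real.cos (γ * s) := by
  unfold HypInteg.kernel dampedPower; ring

theorem integrableOn_kernel {α σ : ℝ} (hα : 0 < α) (hσ : 0 < σ) (γ : ℝ) :
    IntegrableOn (HypInteg.kernel α σ γ) (Ioi 0) := by
  have : HypInteg.kernel α σ γ = fun s => dampedPower α σ s * Real.cos (γ * s) :=
    funext (kernel_eq α σ γ)
  rw [this]
  exact Integrable.mul_bdd (c := 1) (integrableOn_dampedPower hα hσ)
    (Continuous.aestronglyMeasurable (by fun_prop))
    (Filter.Eventually.of_forall fun q => by simpa using Real.abs_cos_le_one _)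

theorem continuousOn_kernel (α σ γ : ℝ) : ContinuousOn (HypInteg.kernel α σ γ) (Ioi 0) :=
  ((continuousOn_dampedPower α σ).mul (by fun_prop : ContinuousOn (fun s => Real.cos (γ * s)) _)).congr
    fun s _ => kernel_eq α σ γ s

theorem abs_kernel_le {α σ : ℝ} (hα : 0 < α) (γ : ℝ) {s : ℝ} (hs : 0 ≤ s) :
    |HypInteg.kernel α σ γ s| ≤ dampedPower α σ s := by
  rw [kernel_eq, abs_mul, abs_of_nonneg (dampedPower_nonneg hα hs)]
  exact mul_le_of_le_one_right (dampedPower_nonneg hα hs) (Real.abs_cos_le_one _)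

theorem integral_abs_kernel_le {α σ : ℝ} (hα : 0 < α) (hσ : 0 < σ) (γ : ℝ) :
    ∫ s in Ioi 0, |HypInteg.kernel α σ γ s| ≤ (1 / σ) ^ α := by
  rw [← integral_dampedPower hα hσ]
  exact setIntegral_mono_on (integrableOn_kernel hα hσ γ).norm (integrableOn_dampedPower hα hσ)
    measurableSet_Ioi fun s hs => abs_kernel_le hα γ (le_of_lt hs)

/-- Write `e^{-σs} = e^{-(σ-1)s} e^{-s}` and use `e^{-s} ≤ e^{-t}` for `s > t`; the remaining factor
is integrable because `σ > 1`. -/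
theorem abs_tail_kernel_le_exp {α σ : ℝ} (hα : 0 < α) (hσ : 1 < σ) (γ : ℝ) {t : ℝ} (ht : 0 ≤ t) :
    |∫ s in Ioi t, HypInteg.kernel α σ γ s| ≤ (1 / (σ - 1)) ^ α * Real.exp (-t) := by
  have hi := integrableOn_dampedPower (σ := σ - 1) hα (by linarith)
  have hsub : Ioi t ⊆ Ioi 0 := Ioi_subset_Ioi ht
  calc |∫ s in Ioi t, HypInteg.kernel α σ γ s|
      ≤ ∫ s in Ioi t, |HypInteg.kernel α σ γ s| :=
        norm_integral_le_integral_norm (μ := volume.restrict (Ioi t)) (HypInteg.kernel α σ γ)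
    _ ≤ ∫ s in Ioi t, dampedPower α (σ - 1) s * Real.exp (-t) := by
        refine setIntegral_mono_on
          ((integrableOn_kernel hα (by linarith : 0 < σ) γ).mono_set hsub).norm
          ((hi.mono_set hsub).mul_const _) measurableSet_Ioi fun s hs => ?_
        have hs0 : 0 ≤ s := ht.trans (le_of_lt hs)
        refine (abs_kernel_le hα γ hs0).trans ?_
        have e : dampedPower α σ s = dampedPower α (σ - 1) s * Real.exp (-s) := by
          unfold dampedPower
          rw [show -σ * s = -(σ - 1) * s + -s by ring, Real.exp_add]; ring
        rw [e]
        refine mul_le_mul_of_nonneg_left ?_ (dampedPower_nonneg hα hs0)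
        exact Real.exp_le_exp.2 (neg_le_neg (le_of_lt hs))
    _ = (∫ s in Ioi t, dampedPower α (σ - 1) s) * Real.exp (-t) := integral_mul_const _ _
    _ ≤ (∫ s in Ioi 0, dampedPower α (σ - 1) s) * Real.exp (-t) := by
        refine mul_le_mul_of_nonneg_right ?_ (Real.exp_pos _).le
        refine setIntegral_mono_set hi ?_ (Filter.Eventually.of_forall hsub)
        filter_upwards [ae_restrict_mem measurableSet_Ioi] with s hs
        exact dampedPower_nonneg hα (le_of_lt hs)
    _ = _ := by rw [integral_dampedPower hα (by linarith)]

/-- Product-to-sum for `cos (γ s) sin (η s)`: the oscillation of the kernel only shifts the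
frequency by `±γ`. -/
theorem integral_kernel_mul_sin {α σ : ℝ} (hα : 0 < α) (hσ : 0 < σ) (γ η : ℝ) :
    ∫ s in Ioi 0, HypInteg.kernel α σ γ s * Real.sin (η * s)
      = (dampedSine α σ (η + γ) + dampedSine α σ (η - γ)) / 2 := by
  have hi : ∀ y, IntegrableOn (fun s => dampedPower α σ s * Real.sin (y * s)) (Ioi 0) := fun y =>
    Integrable.mul_bdd (c := 1) (integrableOn_dampedPower hα hσ)
      (Continuous.aestronglyMeasurable (by fun_prop))
      (Filter.Eventually.of_forall fun q => by simpa using Real.abs_sin_le_one _)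
  unfold dampedSine
  rw [← integral_add (hi _) (hi _), ← integral_div]
  refine integral_congr_ae (Filter.Eventually.of_forall fun s => ?_)
  simp only [kernel_eq, add_mul, sub_mul, Real.sin_add, Real.sin_sub]
  ring

theorem dampedSine_neg (α σ y : ℝ) : dampedSine α σ (-y) = -dampedSine α σ y := by
  unfold dampedSine
  rw [← integral_neg]
  simp [neg_mul, Real.sin_neg]

theorem dampedSine_one {σ : ℝ} (hσ : 0 < σ) (y : ℝ) : dampedSine 1 σ y = y / (σ ^ 2 + y ^ 2) := by
  have hre : (-(σ : ℂ) + y * Complex.I).re < 0 := by simpa using hσ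
  have hi := integrableOn_exp_mul_complex_Ioi hre 0
  have h := congrArg Complex.im (integral_exp_mul_complex_Ioi hre 0)
  have h2 := Complex.imCLM.integral_comp_comm hi
  simp only [Complex.imCLM_apply] at h2
  have e : dampedSine 1 σ y
      = ∫ s : ℝ in Ioi 0, (Complex.exp ((-(σ : ℂ) + y * Complex.I) * s)).im := by
    unfold dampedSine dampedPower
    refine integral_congr_ae (Filter.Eventually.of_forall fun s => ?_)
    simp [Complex.exp_im, Real.Gamma_one]
  rw [e, h2, h]
  simp [Complex.div_im, Complex.normSq_apply]
  ring

/-- The substitution `s = x²` removes the singularity `s^{-1/2}` and leaves the imaginary part of a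
complex Gaussian integral with parameter `σ - iy`. -/
theorem dampedSine_half_eq {σ : ℝ} (hσ : 0 < σ) (y : ℝ) :
    dampedSine (1 / 2) σ y
      = ((Real.pi / ((σ : ℂ) - y * Complex.I)) ^ (1 / 2 : ℂ)).im / √Real.pi := by
  have hre : 0 < ((σ : ℂ) - y * Complex.I).re := by simpa using hσ
  have h := congrArg Complex.im (integral_gaussian_complex_Ioi hre)
  have hi : IntegrableOn (fun x : ℝ => Complex.exp (-((σ : ℂ) - y * Complex.I) * (x : ℂ) ^ 2))
      (Ioi 0) := (integrable_cexp_neg_mul_sq hre).integrableOn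
  have h2 := Complex.imCLM.integral_comp_comm hi
  simp only [Complex.imCLM_apply] at h2
  have e : dampedSine (1 / 2) σ y = ∫ x : ℝ in Ioi 0, 2 / √Real.pi
      * (Complex.exp (-((σ : ℂ) - y * Complex.I) * (x : ℂ) ^ 2)).im := by
    unfold dampedSine dampedPower
    rw [← integral_comp_rpow_Ioi_of_pos (two_pos : (0 : ℝ) < 2)]
    refine setIntegral_congr_fun measurableSet_Ioi fun x hx => ?_
    have hx : 0 < x := hx
    have h1 : (x ^ (2 : ℝ)) ^ ((1 / 2 : ℝ) - 1) = x⁻¹ := by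
      rw [← Real.rpow_mul hx.le, ← Real.rpow_neg_one]; norm_num
    have h3 : x ^ ((2 : ℝ) - 1) = x := by norm_num
    have h4 : (Complex.exp (-((σ : ℂ) - y * Complex.I) * (x : ℂ) ^ 2)).im
        = Real.exp (-σ * x ^ 2) * Real.sin (y * x ^ 2) := by
      have hr : ∀ r : ℝ, (Complex.exp (-((σ : ℂ) - y * Complex.I) * (r : ℂ))).im
          = Real.exp (-σ * r) * Real.sin (y * r) := fun r => by simp [Complex.exp_im]
      rw [← hr, Complex.ofReal_pow]
    simp only [smul_eq_mul]
    rw [h1, h3, h4, Real.Gamma_one_half_eq, Real.rpow_two]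
    field_simp
  rw [e, integral_const_mul, h2, h]
  have : ((Real.pi / ((σ : ℂ) - y * Complex.I)) ^ (1 / 2 : ℂ) / 2).im
      = ((Real.pi / ((σ : ℂ) - y * Complex.I)) ^ (1 / 2 : ℂ)).im / 2 := by
    simp
  rw [this]
  ring

/-- The witness is the real part of the principal square root of `1/(σ - iy)`, of which the sine
transform is the imaginary part. The equations are the two components of its square, and `x ≥ 0`
because a principal root has argument in `(-π/2, π/2]`. -/
theorem exists_sqrt_dampedSine_half {σ : ℝ} (hσ : 0 < σ) (y : ℝ) :
    ∃ x : ℝ, 0 ≤ x ∧ x ^ 2 - dampedSine (1 / 2) σ y ^ 2 = σ / (σ ^ 2 + y ^ 2) ∧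
      2 * x * dampedSine (1 / 2) σ y = y / (σ ^ 2 + y ^ 2) := by
  set z : ℂ := (Real.pi / ((σ : ℂ) - y * Complex.I)) ^ (1 / 2 : ℂ) with hz
  have hπ : 0 < Real.pi := Real.pi_pos
  have hs : √Real.pi ^ 2 = Real.pi := Real.sq_sqrt hπ.le
  have hz2 : z ^ 2 = Real.pi / ((σ : ℂ) - y * Complex.I) := by
    rw [hz, show (1 / 2 : ℂ) = ((2 : ℕ) : ℂ)⁻¹ by norm_num]
    exact Complex.cpow_nat_inv_pow _ two_ne_zero
  have hn : 0 < σ ^ 2 + y ^ 2 := by positivity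
  have hre := congrArg Complex.re hz2
  have him := congrArg Complex.im hz2
  simp only [pow_two, Complex.mul_re, Complex.mul_im, Complex.div_re, Complex.div_im,
    Complex.normSq_apply, Complex.sub_re, Complex.sub_im, Complex.ofReal_re, Complex.ofReal_im,
    Complex.I_re, Complex.I_im] at hre him
  have hzre : 0 ≤ z.re := by
    rw [hz, show (1 / 2 : ℂ) = ((1 / 2 : ℝ) : ℂ) by norm_num, Complex.cpow_ofReal_re]
    refine mul_nonneg (by positivity) (Real.cos_nonneg_of_neg_pi_div_two_le_of_le ?_ ?_)
    · linarith [Complex.neg_pi_lt_arg (Real.pi / ((σ : ℂ) - y * Complex.I))]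
    · linarith [Complex.arg_le_pi (Real.pi / ((σ : ℂ) - y * Complex.I))]
  refine ⟨z.re / √Real.pi, by positivity, ?_, ?_⟩
  · rw [dampedSine_half_eq hσ, div_pow, div_pow, hs, ← sub_div, div_eq_div_iff hπ.ne' hn.ne']
    have : z.re ^ 2 - z.im ^ 2 = Real.pi * σ / (σ ^ 2 + y ^ 2) := by
      rw [pow_two, pow_two, hre]; ring_nf
    rw [this]; field_simp
  · rw [dampedSine_half_eq hσ]
    have h1 : 2 * (z.re / √Real.pi) * (z.im / √Real.pi) = 2 * (z.re * z.im) / √Real.pi ^ 2 := by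
      ring
    have : 2 * (z.re * z.im) = Real.pi * y / (σ ^ 2 + y ^ 2) := by
      have : 2 * (z.re * z.im) = z.re * z.im + z.im * z.re := by ring
      rw [this, him]; ring_nf
    rw [h1, hs, this]; field_simp

theorem dampedSine_half_nonneg {σ y : ℝ} (hσ : 0 < σ) (hy : 0 ≤ y) :
    0 ≤ dampedSine (1 / 2) σ y := by
  rcases hy.eq_or_lt with rfl | hy
  · simp [dampedSine]
  obtain ⟨x, hx, -, h⟩ := exists_sqrt_dampedSine_half hσ y
  have : 0 < y / (σ ^ 2 + y ^ 2) := by positivity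
  rw [← h] at this
  exact (pos_of_mul_pos_right this (by positivity)).le

/-- The squared modulus of the root is the modulus of `1/(σ - iy)`, which gives the sum of the two
squares; their difference is already known. -/
theorem sq_dampedSine_half {σ : ℝ} (hσ : 0 < σ) (y : ℝ) :
    dampedSine (1 / 2) σ y ^ 2
      = (1 / √(σ ^ 2 + y ^ 2) - σ * (1 / √(σ ^ 2 + y ^ 2)) ^ 2) / 2 := by
  obtain ⟨x, hx, h1, h2⟩ := exists_sqrt_dampedSine_half hσ y
  have hn : 0 < σ ^ 2 + y ^ 2 := by positivity
  have hs : (1 / √(σ ^ 2 + y ^ 2)) ^ 2 = 1 / (σ ^ 2 + y ^ 2) := by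
    rw [div_pow, Real.sq_sqrt hn.le, one_pow]
  have h3 : x ^ 2 + dampedSine (1 / 2) σ y ^ 2 = 1 / √(σ ^ 2 + y ^ 2) := by
    refine (sq_eq_sq₀ (by positivity) (by positivity)).1 ?_
    rw [hs]
    have : (x ^ 2 + dampedSine (1 / 2) σ y ^ 2) ^ 2
        = (x ^ 2 - dampedSine (1 / 2) σ y ^ 2) ^ 2 + (2 * x * dampedSine (1 / 2) σ y) ^ 2 := by ring
    rw [this, h1, h2]
    field_simp
  rw [hs]
  have : σ * (1 / (σ ^ 2 + y ^ 2)) = σ / (σ ^ 2 + y ^ 2) := by ring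
  linarith

/-- With `a = 1/√A ≤ b = 1/√B`, comparing squares reduces the claim to `(b - a)(σ(a + b) - 1) ≥ 0`.
Now `σ²(a + b)² ≥ 4σ²ab ≥ 1`, provided `AB ≤ 16σ⁴`. At `η = 0` that condition reads `γ² ≤ 3σ²`,
which is where `√3` comes from. -/
theorem dampedSine_half_le_of_lt {σ γ η : ℝ} (hσ : 0 < σ) (hη : 0 ≤ η) (hηγ : η ≤ γ)
    (hγ : γ ^ 2 ≤ 3 * σ ^ 2) :
    dampedSine (1 / 2) σ (γ - η) ≤ dampedSine (1 / 2) σ (γ + η) := by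
  refine abs_le_of_sq_le_sq' ?_ (dampedSine_half_nonneg hσ (by linarith)) |>.2
  rw [sq_dampedSine_half hσ, sq_dampedSine_half hσ]
  set A := σ ^ 2 + (γ + η) ^ 2 with hA
  set B := σ ^ 2 + (γ - η) ^ 2 with hB
  have hA0 : 0 < A := by positivity
  have hB0 : 0 < B := by positivity
  have hBA : B ≤ A := by rw [hA, hB]; nlinarith [mul_nonneg hη (hη.trans hηγ)]
  have hAB : A * B ≤ (4 * σ ^ 2) ^ 2 := by
    have e : A * B = (σ ^ 2) ^ 2 + 2 * σ ^ 2 * (γ ^ 2 + η ^ 2) + (γ ^ 2 - η ^ 2) ^ 2 := by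
      rw [hA, hB]; ring
    have hb : η ^ 2 ≤ γ ^ 2 := by gcongr
    rw [e]
    -- What remains is `s² + 2s(a + b) + (a - b)² ≤ 16s²` for `0 ≤ b ≤ a ≤ 3s`.
    generalize σ ^ 2 = s at *
    have hb0 := sq_nonneg η
    generalize η ^ 2 = b at *
    generalize γ ^ 2 = a at *
    nlinarith [mul_nonneg (sub_nonneg.2 hb) hb0, mul_nonneg (sub_nonneg.2 hb) (sub_nonneg.2 hγ),
      mul_nonneg (hb0.trans hb) (sub_nonneg.2 hγ), mul_nonneg hb0 (sub_nonneg.2 hγ)]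
  have hρ : 1 / √A ≤ 1 / √B := by gcongr
  have hprod : 1 / (4 * σ ^ 2) ≤ 1 / √A * (1 / √B) := by
    rw [one_div_mul_one_div, ← Real.sqrt_mul hA0.le]
    gcongr
    exact Real.sqrt_le_iff.2 ⟨by positivity, hAB⟩
  have ha0 : 0 < 1 / √A := by positivity
  have hb0 : 0 < 1 / √B := by positivity
  generalize 1 / √A = a at *
  generalize 1 / √B = b at *
  have hsum : 1 ≤ σ * (a + b) := by
    have h1 : 1 ≤ 4 * σ ^ 2 * (a * b) := by
      rwa [div_le_iff₀' (by positivity)] at hprod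
    rw [← one_le_sq_iff₀ (by positivity)]
    nlinarith [mul_nonneg (sq_nonneg σ) (sq_nonneg (a - b))]
  nlinarith [mul_le_mul_of_nonneg_left hsum (sub_nonneg.2 hρ)]

/-! ### Sign and decay of the sine transform of the kernel. -/

/-- For `α = 1` the two shifted fractions combine to a numerator `2η(σ² - γ² + η²)`. For `α = 1/2`
both shifted terms are nonnegative when `η ≥ γ`; when `η ≤ γ`, oddness makes one of them negative or
zero, and the other dominates it. -/
theorem integral_kernel_mul_sin_nonneg {α σ γ : ℝ} (h : HypInteg.KernelCond α σ γ) {η : ℝ}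
    (hη : 0 < η) : 0 ≤ ∫ s in Ioi 0, HypInteg.kernel α σ γ s * Real.sin (η * s) := by
  rcases h with ⟨rfl, hσ, hγ0, hγ⟩ | ⟨rfl, hσ, hγ0, hγ⟩
  · have hσ0 : 0 < σ := by linarith
    rw [integral_kernel_mul_sin one_pos hσ0, dampedSine_one hσ0, dampedSine_one hσ0]
    have e : (η + γ) / (σ ^ 2 + (η + γ) ^ 2) + (η - γ) / (σ ^ 2 + (η - γ) ^ 2)
        = 2 * η * (σ ^ 2 - γ ^ 2 + η ^ 2)
          / ((σ ^ 2 + (η + γ) ^ 2) * (σ ^ 2 + (η - γ) ^ 2)) := by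
      field_simp
      ring
    have h1 : 0 ≤ σ ^ 2 - γ ^ 2 := sub_nonneg.2 (by gcongr)
    rw [e]
    positivity
  · have hσ0 : 0 < σ := by linarith
    rw [integral_kernel_mul_sin (by norm_num) hσ0]
    have hγ2 : γ ^ 2 ≤ 3 * σ ^ 2 := by
      calc γ ^ 2 ≤ (√3 * σ) ^ 2 := by gcongr
        _ = 3 * σ ^ 2 := by rw [mul_pow, Real.sq_sqrt (by norm_num)]
    rcases le_total γ η with hle | hle
    · have h1 := dampedSine_half_nonneg (y := η + γ) hσ0 (by linarith)
      have h2 := dampedSine_half_nonneg (y := η - γ) hσ0 (by linarith)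
      positivity
    · have h1 := dampedSine_half_le_of_lt hσ0 hη.le hle hγ2
      have h2 := dampedSine_neg (1 / 2) σ (γ - η)
      rw [neg_sub] at h2
      rw [h2, add_comm η γ]
      linarith

theorem dampedSine_le_rpow {α σ y : ℝ} (hα : α = 1 ∨ α = 1 / 2) (hσ : 0 < σ) (hy : 1 ≤ y) :
    dampedSine α σ y ≤ y ^ (-(1 / 2) : ℝ) := by
  have hy0 : 0 < y := by linarith
  rcases hα with rfl | rfl
  · rw [dampedSine_one hσ]
    calc y / (σ ^ 2 + y ^ 2) ≤ y / y ^ 2 := by gcongr; nlinarith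
      _ = y ^ (-1 : ℝ) := by rw [Real.rpow_neg_one]; field_simp
      _ ≤ y ^ (-(1 / 2) : ℝ) := Real.rpow_le_rpow_of_exponent_le hy (by norm_num)
  · refine abs_le_of_sq_le_sq' ?_ (by positivity) |>.2
    have hp : (y ^ (-(1 / 2) : ℝ)) ^ 2 = 1 / y := by
      rw [← Real.rpow_natCast, ← Real.rpow_mul hy0.le, show -(1 / 2 : ℝ) * ((2 : ℕ) : ℝ) = -1 by norm_num,
        Real.rpow_neg_one, one_div]
    rw [sq_dampedSine_half hσ, hp]
    have h1 : 1 / √(σ ^ 2 + y ^ 2) ≤ 1 / y := by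
      gcongr
      exact Real.le_sqrt_of_sq_le (by nlinarith)
    have h2 : 0 ≤ σ * (1 / √(σ ^ 2 + y ^ 2)) ^ 2 := by positivity
    have h3 : 0 < 1 / y := by positivity
    linarith

/-- The threshold `2γ + 2` ensures that both shifted frequencies `η ± γ` are at least `η/2 ≥ 1`,
where the power bound applies. -/
theorem integral_kernel_mul_sin_le {α σ γ : ℝ} (h : HypInteg.KernelCond α σ γ) {η : ℝ}
    (hη : 2 * γ + 2 ≤ η) :
    ∫ s in Ioi 0, HypInteg.kernel α σ γ s * Real.sin (η * s)
      ≤ (1 / 2) ^ (-(1 / 2) : ℝ) * η ^ (-(1 / 2) : ℝ) := by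
  obtain ⟨hα, hσ, hγ⟩ : (α = 1 ∨ α = 1 / 2) ∧ 0 < σ ∧ 0 ≤ γ := by
    rcases h with ⟨h1, h2, h3, -⟩ | ⟨h1, h2, h3, -⟩
    · exact ⟨Or.inl h1, by linarith, h3⟩
    · exact ⟨Or.inr h1, by linarith, h3⟩
  have hα0 : 0 < α := by rcases hα with rfl | rfl <;> norm_num
  rw [integral_kernel_mul_sin hα0 hσ, ← Real.mul_rpow (by norm_num) (by linarith)]
  have key : ∀ y, 1 / 2 * η ≤ y → dampedSine α σ y ≤ (1 / 2 * η) ^ (-(1 / 2) : ℝ) := fun y hy =>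
    (dampedSine_le_rpow hα hσ (by linarith)).trans
      (Real.rpow_le_rpow_of_nonpos (by linarith) hy (by norm_num))
  linarith [key (η + γ) (by linarith), key (η - γ) (by linarith)]

/-- The tail `∫_t^∞ β` of the kernel is of positive type. -/
theorem integral_triangle_tail_kernel_nonneg {α σ γ : ℝ} (h : HypInteg.KernelCond α σ γ)
    {H : Type*} [NormedAddCommGroup H] [InnerProductSpace ℝ H] [CompleteSpace H]
    {T : ℝ} (hT : 0 ≤ T) {φ : ℝ → H} (hφ : IntegrableOn φ (Ioc 0 T)) :
    0 ≤ ∫ t in (0 : ℝ)..T, ∫ s in (0 : ℝ)..t,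
      (∫ r in Ioi (t - s), HypInteg.kernel α σ γ r) * inner ℝ (φ s) (φ t) := by
  obtain ⟨hα, hσ, hγ⟩ : 0 < α ∧ 1 < σ ∧ 0 ≤ γ := by
    rcases h with ⟨rfl, h2, h3, -⟩ | ⟨rfl, h2, h3, -⟩
    · exact ⟨one_pos, h2, h3⟩
    · exact ⟨by norm_num, h2, h3⟩
  have hβ := integrableOn_kernel hα (by linarith : 0 < σ) γ
  obtain ⟨R, hR, hR0, hK⟩ := exists_cos_density_of_sineTransform_nonneg (continuousOn_tail hβ)
    (fun t ht => hasDerivAt_tail hβ (continuousOn_kernel α σ γ) ht) hβ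
    (fun t ht => abs_tail_kernel_le_exp hα hσ γ ht)
    (fun η hη => integral_kernel_mul_sin_nonneg h hη) (by linarith : 0 < 2 * γ + 2)
    (fun η hη => integral_kernel_mul_sin_le h hη)
  exact integral_triangle_nonneg_of_cos (K := fun t => ∫ r in Ioi t, HypInteg.kernel α σ γ r)
    hR hR0 hK hT hφ

/-! ### Application to the Galerkin scheme. -/

/-- The function component, as a continuous linear map on a subspace of `L²(Ω) × L²(Ω; ℝ^d)`. -/
noncomputable def fstCLM {d : ℕ} {Ω : Set (HypInteg.E d)} (S : Submodule ℝ (HypInteg.L2Pair Ω)) :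
    S →L[ℝ] HypInteg.L2 Ω :=
  (WithLp.fstL 2 ℝ (HypInteg.L2 Ω) (HypInteg.L2Vec Ω)).comp S.subtypeL

/-- The gradient component, as a continuous linear map on a subspace of `L²(Ω) × L²(Ω; ℝ^d)`. -/
noncomputable def sndCLM {d : ℕ} {Ω : Set (HypInteg.E d)} (S : Submodule ℝ (HypInteg.L2Pair Ω)) :
    S →L[ℝ] HypInteg.L2Vec Ω :=
  (WithLp.sndL 2 ℝ (HypInteg.L2 Ω) (HypInteg.L2Vec Ω)).comp S.subtypeL

/-- The abstract estimate applies with `p` the function component of `u'`, `w` the gradient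
component of `u`, and `m = σ^{-α}`, which bounds both the mass of `β` and its tail. -/
theorem HypInteg.IsGalerkinSolution.norm_add_norm_le {α σ γ : ℝ}
    (hβ : HypInteg.KernelCond α σ γ) {d : ℕ} {Ω : Set (HypInteg.E d)}
    {μ₁ μ₂ : ℝ} (hμ₁ : 0 ≤ μ₁) (hμ₂ : 0 ≤ μ₂) {G : ℝ → ℝ} (hG : ∀ z, 0 ≤ z → 0 ≤ G z)
    {T : ℝ≥0∞} {f : ℝ → HypInteg.L2 Ω} (hf : IntegrableOn f (HypInteg.timeInterval T) volume)
    {S : Submodule ℝ (HypInteg.L2Pair Ω)} [FiniteDimensional ℝ S]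
    {u₀ u₁ : S} {u du ddu : ℝ → S}
    (hu : HypInteg.IsGalerkinSolution S (HypInteg.kernel α σ γ) G μ₁ μ₂ T f u₀ u₁ u du ddu)
    {t : ℝ} (ht : 0 ≤ t) (htT : ENNReal.ofReal t ≤ T) :
    ‖(du t : HypInteg.L2Pair Ω).fst‖ + ‖(u t : HypInteg.L2Pair Ω).snd‖
      ≤ (1 + 1 / √(1 - (1 / σ) ^ α)) * (8 / √(1 - (1 / σ) ^ α))
        * (‖(u₁ : HypInteg.L2Pair Ω).fst‖ + ‖(u₀ : HypInteg.L2Pair Ω).snd‖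
            + ∫ s in (0 : ℝ)..t, ‖f s‖) := by
  obtain ⟨hα, hσ⟩ : 0 < α ∧ 1 < σ := by
    rcases hβ with ⟨rfl, h2, -, -⟩ | ⟨rfl, h2, -, -⟩
    · exact ⟨one_pos, h2⟩
    · exact ⟨by norm_num, h2⟩
  have hσ0 : 0 < σ := by linarith
  have hβi := integrableOn_kernel hα hσ0 γ
  have hm : (1 / σ) ^ α < 1 :=
    Real.rpow_lt_one (by positivity) (by rw [div_lt_one hσ0]; exact hσ) hα
  have hβm := integral_abs_kernel_le hα hσ0 γ
  have hsub : Icc 0 t ⊆ HypInteg.timeInterval T := fun s hs =>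
    ⟨hs.1, (ENNReal.ofReal_le_ofReal hs.2).trans htT⟩
  have hsub' : Ioc 0 t ⊆ HypInteg.timeInterval T := Ioc_subset_Icc_self.trans hsub
  have : CompleteSpace S := FiniteDimensional.complete ℝ S
  have htm : t ∈ HypInteg.timeInterval T := ⟨ht, htT⟩
  have hddu : IntegrableOn ddu (Ioc 0 t) :=
    (intervalIntegrable_iff_integrableOn_Ioc_of_le ht).1 (hu.integrable t htm)
  have hduc : ContinuousOn du (Icc 0 t) := by
    have : ContinuousOn (fun t => ∫ s in (0 : ℝ)..t, ddu s) (uIcc 0 t) :=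
      intervalIntegral.continuousOn_primitive_interval
        (by rw [uIcc_of_le ht]; exact (integrableOn_Icc_iff_integrableOn_Ioc).2 hddu)
    rw [uIcc_of_le ht] at this
    exact (continuousOn_const.add this).congr fun s hs => hu.deriv_eq s (hsub hs)
  have key := norm_add_norm_le_of_positive_type
    (K := fun t => ∫ r in Ioi t, HypInteg.kernel α σ γ r) hm (continuousOn_tail hβi)
    (fun t ht => hasDerivAt_tail hβi (continuousOn_kernel α σ γ) ht) hβi hβm
    (fun t ht => (abs_tail_le hβi ht).trans hβm)
    (fun T hT φ hφ => integral_triangle_tail_kernel_nonneg hβ hT hφ) ht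
    (p := fun s => fstCLM S (du s)) (p' := fun s => fstCLM S (ddu s))
    (w := fun s => sndCLM S (u s)) (w' := fun s => sndCLM S (du s)) (F := fun s => ‖f s‖)
    (by
      rw [intervalIntegrable_iff_integrableOn_Ioc_of_le ht]
      exact (fstCLM S).integrable_comp hddu)
    (fun s hs => by
      rw [hu.deriv_eq s (hsub hs), map_add,
        (fstCLM S).intervalIntegral_comp_comm (hu.integrable s (hsub hs))])
    (fun s hs => (sndCLM S).hasFDerivAt.comp_hasDerivWithinAt s
      ((hu.hasDeriv s (hsub hs)).mono hsub))
    ((sndCLM S).continuous.comp_continuousOn hduc)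
    (by
      rw [intervalIntegrable_iff_integrableOn_Ioc_of_le ht]
      exact (hf.mono_set hsub').norm)
    (fun s => norm_nonneg _)
    (by
      filter_upwards [ae_restrict_of_ae_restrict_of_subset hsub' hu.equation] with s hs
      -- The test function is `u'(s)`, admissible because it lies in `S`; the damping term then has
      -- a sign and is discarded.
      have h1 := hs (du s)
      have h2 := real_inner_le_norm (f s) (du s : HypInteg.L2Pair Ω).fst
      have h3 : 0 ≤ G (μ₁ * ‖(u s : HypInteg.L2Pair Ω).fst‖ ^ 2
          + μ₂ * ‖(u s : HypInteg.L2Pair Ω).snd‖ ^ 2)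
          * inner ℝ (du s : HypInteg.L2Pair Ω).fst (du s : HypInteg.L2Pair Ω).fst :=
        mul_nonneg (hG _ (by positivity)) real_inner_self_nonneg
      change inner ℝ (ddu s : HypInteg.L2Pair Ω).fst (du s : HypInteg.L2Pair Ω).fst
        + inner ℝ (u s : HypInteg.L2Pair Ω).snd (du s : HypInteg.L2Pair Ω).snd
        - ∫ r in (0 : ℝ)..s, HypInteg.kernel α σ γ (s - r)
            * inner ℝ (u r : HypInteg.L2Pair Ω).snd (du s : HypInteg.L2Pair Ω).snd
        ≤ ‖f s‖ * ‖(du s : HypInteg.L2Pair Ω).fst‖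
      linarith)
  rw [hu.init, hu.init_deriv] at key
  exact key

theorem theorem3p1 (α σ γ : ℝ) (hβ : HypInteg.KernelCond α σ γ) :
    ∃ C : ℝ, 0 < C ∧
      ∀ (d : ℕ) (_ : 1 ≤ d) (_ : d ≤ 3)
        (Ω : Set (HypInteg.E d)) (_ : HypInteg.IsSmoothBoundedDomain Ω)
        (μ₁ μ₂ : ℝ) (_ : 0 ≤ μ₁) (_ : 0 ≤ μ₂) (_ : 0 < μ₁ ^ 2 + μ₂ ^ 2)
        (G : ℝ → ℝ) (L : ℝ) (_ : HypInteg.DampingCond G L)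
        (T : ℝ≥0∞) (_ : 0 < T)
        (f : ℝ → HypInteg.L2 Ω) (_ : IntegrableOn f (HypInteg.timeInterval T) volume)
        (S : Submodule ℝ (HypInteg.L2Pair Ω)) (_ : S ≤ HypInteg.H10 Ω)
        (_ : FiniteDimensional ℝ S)
        (u₀ u₁ : S) (u du ddu : ℝ → S)
        (_ : HypInteg.IsGalerkinSolution S (HypInteg.kernel α σ γ) G μ₁ μ₂ T f u₀ u₁ u du ddu),
        ∀ t : ℝ, 0 < t → ENNReal.ofReal t ≤ T →
          ‖(du t : HypInteg.L2Pair Ω).fst‖ + ‖(u t : HypInteg.L2Pair Ω).snd‖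
            ≤ C * (‖(u₁ : HypInteg.L2Pair Ω).fst‖ + ‖(u₀ : HypInteg.L2Pair Ω).snd‖
                + ∫ s in (0 : ℝ)..t, ‖f s‖) := by
  obtain ⟨hα, hσ⟩ : 0 < α ∧ 1 < σ := by
    rcases hβ with ⟨rfl, h2, -, -⟩ | ⟨rfl, h2, -, -⟩
    · exact ⟨one_pos, h2⟩
    · exact ⟨by norm_num, h2⟩
  have hm : (1 / σ) ^ α < 1 :=
    Real.rpow_lt_one (by positivity) (by rw [div_lt_one (by linarith)]; exact hσ) hα
  have hr : 0 < √(1 - (1 / σ) ^ α) := Real.sqrt_pos.2 (by linarith)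
  refine ⟨(1 + 1 / √(1 - (1 / σ) ^ α)) * (8 / √(1 - (1 / σ) ^ α)), by positivity, ?_⟩
  intro d _ _ Ω _ μ₁ μ₂ hμ₁ hμ₂ _ G L hG T _ f hf S _ _ u₀ u₁ u du ddu hu t ht htT
  exact hu.norm_add_norm_le hβ hμ₁ hμ₂ hG.nonneg hf ht.le htT
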